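/- **Setting.** Let $0<\eta<1/2$ (the noise rate), $t\ge 0$, and $p=\Pr_{Z\sim N(0,1)}[Z>t]\in(0,1/2]$. For a unit vector $v\in\mathbb R^d$ put $f_v(x)=\mathrm{sign}(v\cdot x-t)$, and let $G$ be the standard Gaussian law (density) on $\mathbb R^d$. Let $$A_v(x)=G(x)\,\frac{\eta+(1-2\eta)\mathbf 1\{f_v(x)>0\}}{\eta+(1-2\eta)p},\qquad B_v(x)=G(x)\,\frac{1-\eta-(1-2\eta)\mathbf 1\{f_v(x)>0\}}{1-\eta-(1-2\eta)p}.$$ Let $\rho\in[0,1]$. Under the null law $D_0$ on $\mathbb R^d\times\{\pm1\}$, $x\sim G$ and $y$ is independent of $x$ with $\Pr[y=1]=\rho$. Under $E_v$, the label $y$ has the same marginal, and $x$ has conditional law $A_v$ given $y=1$ and $B_v$ given $y=-1$. (For $\rho=\eta+(1-2\eta)p$, $E_v$ is the law of a standard Gaussian $x$ with label $f_v(x)$ flipped with probability $\eta$.) For a finite set $S$ of unit vectors the testing problem is $D_0^{\otimes n}$ versus $E_v^{\otimes n}$ with $v$ uniform on $S$. A polynomial in the coordinates of $n$ samples has samplewise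 degree $(r,l)$ if each of its monomials uses at most $l$ different samples and has degree at most $r$ in each of them ($r=\infty$: no restriction). For $f\in L^2(D_0^{\otimes n})$, $f^{\le r,l}$ is its orthogonal projection onto the closure of the space of polynomials of samplewise degree $(r,l)$. Write $\bar E_v^{\otimes n}$ for the likelihood ratio of $E_v^{\otimes n}$ with respect to $D_0^{\otimes n}$. **Theorem.** There are absolute constants $\kappa,a>0$, and for all $\eta\in(0,1/2)$ and $C>0$ there is $\delta=\delta(\eta,C)>0$, such that the following holds for every $0<c<1/2$ and every sufficiently large $d$ (depending on $c,\eta,C$). There is a set $S$ of at least $2^{a d^c}$ unit vectors of $\mathbb R^d$ with $|v\cdot u|<d^{-1/2+c}$ for all distinct $v,u\in S$, such that for all $t\ge0$ with $t\le \tfrac12 d^{1/4-c/2}$ and $p\ge 2^{-Cd^c}$, all $\rho\in[0,1]$, all $n\le(\delta d)^{1/2-c}/p^2$, all even $k<d^{c/4}$ and all integers $0\le l\le\kappa k$: for each $v\in S$, $E_v^{\otimes n}$ is absolutely continuous with respect to $D_0^{\otimes n}$ with likelihood ratio in $L^2(D_0^{\otimes n})$, and $$\Big\|\mathbb E_{v\sim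 \mathrm{Unif}(S)}\big[(\bar E_v^{\otimes n})^{\le\infty,l}\big]-1\Big\|_{L^2(D_0^{\otimes n})}^2\le 1 .$$ Consequently every polynomial $P$ of samplewise degree $(\infty,l)$ has advantage at most $1$: $$\Big|\mathbb E_{v\sim\mathrm{Unif}(S)}\mathbb E_{X\sim E_v^{\otimes n}}[P(X)]-\mathbb E_{X\sim D_0^{\otimes n}}[P(X)]\Big|\le\sqrt{\mathrm{Var}_{X\sim D_0^{\otimes n}}[P(X)]}.$$ -/

import Mathlib

open MeasureTheory ProbabilityTheory
open scoped ENNReal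

namespace RCNHalfspace

noncomputable section

/-! ### Low-degree polynomials and the low-degree likelihood ratio -/

/-- A labelled example `(x, y)`; the laws below give `y` values in `{1, -1}` only. -/
abbrev Sample (d : ℕ) : Type := EuclideanSpace ℝ (Fin d) × ℝ

/-- The real coordinates of a labelled example: `none` is the label, `some j` the `j`-th entry
of the point. -/
def sampleCoord {d : ℕ} (z : Sample d) : Option (Fin d) → ℝ
  | none => z.2
  | some j => z.1 j

/-- The value of a polynomial in the coordinates of `n` labelled examples. -/
def evalSamples {n d : ℕ} (P : MvPolynomial (Fin n × Option (Fin d)) ℝ)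
    (X : Fin n → Sample d) : ℝ :=
  MvPolynomial.eval (fun ij => sampleCoord (X ij.1) ij.2) P

/-- Samplewise degree `(r, k)`: each monomial uses at most `k` different examples, and has degree
at most `r` in each of them (`r = ⊤` means no restriction). -/
def HasSamplewiseDegree {n d : ℕ} (r : ℕ∞) (k : ℕ)
    (P : MvPolynomial (Fin n × Option (Fin d)) ℝ) : Prop :=
  ∀ m ∈ P.support,
    {i : Fin n | ∃ j, m (i, j) ≠ 0}.ncard ≤ k ∧
    ∀ i : Fin n, ((∑ j, m (i, j) : ℕ) : ℕ∞) ≤ r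

/-- The linear subspace of `L²(Q)` formed by the polynomials of samplewise degree `(r, k)`. -/
def polySubspace {n d : ℕ} (Q : Measure (Fin n → Sample d)) (r : ℕ∞) (k : ℕ) :
    Submodule ℝ (Lp ℝ 2 Q) where
  carrier := {g | ∃ P : MvPolynomial (Fin n × Option (Fin d)) ℝ,
    HasSamplewiseDegree r k P ∧ g =ᵐ[Q] evalSamples P}
  zero_mem' := by
    refine ⟨0, by simp [HasSamplewiseDegree], ?_⟩
    filter_upwards [Lp.coeFn_zero ℝ 2 Q] with x hx
    exact hx.trans (by simp [evalSamples])
  add_mem' := by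
    classical
    rintro f g ⟨P, hP, hf⟩ ⟨R, hR, hg⟩
    refine ⟨P + R, ?_, ?_⟩
    · intro m hm
      rcases Finset.mem_union.1 (MvPolynomial.support_add hm) with h | h
      · exact hP m h
      · exact hR m h
    · filter_upwards [Lp.coeFn_add f g, hf, hg] with x hx h1 h2
      exact hx.trans (by simp [h1, h2, evalSamples])
  smul_mem' := by
    rintro a f ⟨P, hP, hf⟩
    refine ⟨a • P, fun m hm => hP m (MvPolynomial.support_smul hm), ?_⟩
    filter_upwards [Lp.coeFn_smul a f, hf] with x hx h1
    exact hx.trans (by simp [h1, evalSamples, MvPolynomial.smul_eval])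

/-- `f ↦ f^{≤ r, k}`: the orthogonal projection in `L²(Q)` onto (the closure of) the space of
polynomials of samplewise degree `(r, k)`. -/
def lowDegreeProj {n d : ℕ} (Q : Measure (Fin n → Sample d)) (r : ℕ∞) (k : ℕ) :
    Lp ℝ 2 Q →L[ℝ] Lp ℝ 2 Q :=
  (polySubspace Q r k).topologicalClosure.starProjection

/-- The law of `n` independent samples from `D`. -/
abbrev sampleLaw {d : ℕ} (n : ℕ) (D : Measure (Sample d)) : Measure (Fin n → Sample d) :=
  Measure.pi fun _ => D

/-- The likelihood ratio `dP/dQ` as a real function. -/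
def likelihoodRatio {Ω : Type*} [MeasurableSpace Ω] (P Q : Measure Ω) : Ω → ℝ :=
  fun ω => (P.rnDeriv Q ω).toReal

open Classical in
/-- The likelihood ratio `dP/dQ` as an element of `L²(Q)`. It is set to `0` when it is not
square integrable, a case that has to be excluded where this is used. -/
def likelihoodRatioL2 {Ω : Type*} [MeasurableSpace Ω] (P Q : Measure Ω) : Lp ℝ 2 Q :=
  if h : MemLp (likelihoodRatio P Q) 2 Q then h.toLp _ else 0

/-- The centred low-degree likelihood ratio `E_{v ∼ μ}[((D_v^{⊗n}) / (D₀^{⊗n}))^{≤ r, k}] - 1` in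
`L²(D₀^{⊗n})`, where the prior `μ` is the uniform distribution on the finite set `S`. -/
def centredLDLR {d : ℕ} {V : Type*} (D₀ : Measure (Sample d)) [IsFiniteMeasure D₀]
    (S : Finset V) (D : V → Measure (Sample d)) (n : ℕ) (r : ℕ∞) (k : ℕ) :
    Lp ℝ 2 (sampleLaw n D₀) :=
  (S.card : ℝ)⁻¹ •
      ∑ v ∈ S, lowDegreeProj (sampleLaw n D₀) r k
        (likelihoodRatioL2 (sampleLaw n (D v)) (sampleLaw n D₀))
    - Lp.const 2 (sampleLaw n D₀) (1 : ℝ)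

/-! ### The hard family of halfspaces with random classification noise -/

/-- `ℙ[Z > t]` for a standard normal `Z`; this is the probability that the halfspace
`x ↦ sign(v ⬝ x - t)` with a unit vector `v` takes the value `1` under the standard Gaussian. -/
def gaussianTail (t : ℝ) : ℝ := (gaussianReal 0 1).real (Set.Ioi t)

open Classical in
/-- The indicator of the event that `sign(v ⬝ x - t) = 1`. -/
def halfspaceInd {d : ℕ} (t : ℝ) (v x : EuclideanSpace ℝ (Fin d)) : ℝ :=
  if inner ℝ v x - t > 0 then 1 else 0

/-- The law `A_v` of `x` given `y = 1`, when `x` is standard Gaussian and `y = sign(v ⬝ x - t)` is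
flipped with probability `η`. -/
def lawPos {d : ℕ} (η t : ℝ) (v : EuclideanSpace ℝ (Fin d)) :
    Measure (EuclideanSpace ℝ (Fin d)) :=
  (stdGaussian (EuclideanSpace ℝ (Fin d))).withDensity fun x =>
    ENNReal.ofReal ((η + (1 - 2 * η) * halfspaceInd t v x) /
      (η + (1 - 2 * η) * gaussianTail t))

/-- The law `B_v` of `x` given `y = -1`, in the same model. -/
def lawNeg {d : ℕ} (η t : ℝ) (v : EuclideanSpace ℝ (Fin d)) :
    Measure (EuclideanSpace ℝ (Fin d)) :=
  (stdGaussian (EuclideanSpace ℝ (Fin d))).withDensity fun x =>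
    ENNReal.ofReal ((1 - η - (1 - 2 * η) * halfspaceInd t v x) /
      (1 - η - (1 - 2 * η) * gaussianTail t))

/-- The law of `(x, y)` with `ℙ[y = 1] = ρ`, `ℙ[y = -1] = 1 - ρ`, and with `A` and `B` as the
conditional laws of `x` given `y = 1` and `y = -1`. -/
def labelMixture {d : ℕ} (ρ : ℝ) (A B : Measure (EuclideanSpace ℝ (Fin d))) :
    Measure (Sample d) :=
  ENNReal.ofReal ρ • A.map (fun x => (x, (1 : ℝ))) +
    ENNReal.ofReal (1 - ρ) • B.map (fun x => (x, (-1 : ℝ)))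

instance {d : ℕ} (ρ : ℝ) (A B : Measure (EuclideanSpace ℝ (Fin d)))
    [IsFiniteMeasure A] [IsFiniteMeasure B] : IsFiniteMeasure (labelMixture ρ A B) := by
  have h1 := Measure.smul_finite (A.map (fun x => (x, (1 : ℝ)))) (ENNReal.ofReal_ne_top (r := ρ))
  have h2 := Measure.smul_finite (B.map (fun x => (x, (-1 : ℝ))))
    (ENNReal.ofReal_ne_top (r := 1 - ρ))
  unfold labelMixture
  infer_instance

/-- The null law `D₀`: `x` is standard Gaussian and the label is independent of `x`. -/
abbrev nullLaw (d : ℕ) (ρ : ℝ) : Measure (Sample d) :=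
  labelMixture ρ (stdGaussian (EuclideanSpace ℝ (Fin d)))
    (stdGaussian (EuclideanSpace ℝ (Fin d)))

/-- The alternative `E_v`: the label has the same marginal as under the null law, and `A_v`, `B_v`
are the conditional laws of `x`. For `ρ = η + (1 - 2 η) p`, with `p` the Gaussian tail at `t`, this
is the law of a standard Gaussian `x` with the label `sign(v ⬝ x - t)` flipped with
probability `η`. -/
def hardLaw {d : ℕ} (ρ η t : ℝ) (v : EuclideanSpace ℝ (Fin d)) : Measure (Sample d) :=
  labelMixture ρ (lawPos η t v) (lawNeg η t v)

/-- `S` consists of unit vectors of `ℝ^d` any two distinct ones of which satisfy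
`|v ⬝ u| < d^{-1/2+c}`. -/
def NearlyOrthogonal {d : ℕ} (c : ℝ) (S : Finset (EuclideanSpace ℝ (Fin d))) : Prop :=
  (∀ v ∈ S, ‖v‖ = 1) ∧
    ∀ v ∈ S, ∀ u ∈ S, v ≠ u → |inner ℝ v u| < (d : ℝ) ^ (-(1 / 2 : ℝ) + c)

end

end RCNHalfspace

/-! ### One-dimensional Gaussian estimates -/

/-! With respect to the null law, one labelled example under direction `v` has likelihood ratio `1 +
g_v`, where the score `g_v` has mean zero and is bounded by `1/η`. Expand `∏ i, (1 + g_v (X i))`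
over sets `T` of samples. A term with more than `l` factors is orthogonal to every polynomial using
at most `l` samples, whatever its degree in each of them, since some mean-zero factor is left alone
in its coordinate. So the averaged low-degree likelihood ratio minus `1` is the projection of the
average of the truncated products. Distinct sets `T` give orthogonal terms, so the squared norm of
that average is the mean over pairs `u, v` of the sum of `z ^ T.card` over nonempty `T` with at most
`l` elements, where `z = ⟨g_u, g_v⟩` (`low_degree_indistinguishable`).

For `u ≠ v`, `z` is at most `1/η²` times the covariance of two halfspaces, which is `O(|u·v| (1+t)²
p²)` (`abs_cov_halfspaceInd_le`). The bound on `n` then gives `n|z| ≤ √d |u·v| / 12`, so the pair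
contributes at most `cosh (√d u·v) / 6`. For `u = v` the contribution is at most `(n+1)^l exp
(1/η²)`, which is `exp (O(d^(5c/4)))` and hence below half the size `exp (Ω(d^(2c)))` of `S`
(`two_mul_pow_mul_exp_le`).

The set `S` is picked greedily from the cube `{±1/√d}^d` so that it is nearly orthogonal and also
`cosh (√d u·v)` sums to at most `3 |S|²` over distinct pairs (`exists_nearlyOrthogonal`). This
average control is what removes the loss of the pointwise bound `|u·v| < d^(-1/2+c)`. The diagonal
and the rest then give at most one half each. -/

theorem gaussianPDFReal_zero_one (x : ℝ) :
    gaussianPDFReal 0 1 x = (Real.sqrt (2 * Real.pi))⁻¹ * Real.exp (-x ^ 2 / 2) := by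
  simp [gaussianPDFReal]

/-- The exponent `-y²/2` is concave, so it lies below its tangent line at `t`. -/
theorem gaussianPDFReal_le_mul_exp (t y : ℝ) :
    gaussianPDFReal 0 1 y ≤ gaussianPDFReal 0 1 t * Real.exp (t * (t - y)) := by
  rw [gaussianPDFReal_zero_one, gaussianPDFReal_zero_one, mul_assoc, ← Real.exp_add]
  gcongr
  nlinarith [sq_nonneg (t - y)]

theorem gaussianTail_eq_integral (t : ℝ) :
    RCNHalfspace.gaussianTail t = ∫ x in Set.Ioi t, gaussianPDFReal 0 1 x := by
  rw [RCNHalfspace.gaussianTail, measureReal_def,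
    gaussianReal_apply_eq_integral _ one_ne_zero, ENNReal.toReal_ofReal]
  exact integral_nonneg fun x => gaussianPDFReal_nonneg _ _ _

theorem abs_gaussianTail_sub_le {t b : ℝ} (ht : 0 ≤ t) :
    |RCNHalfspace.gaussianTail b - RCNHalfspace.gaussianTail t| ≤
      gaussianPDFReal 0 1 t * Real.exp (t * |b - t|) * |b - t| := by
  have hint := integrable_gaussianPDFReal 0 1
  have h : RCNHalfspace.gaussianTail b - RCNHalfspace.gaussianTail t =
      ∫ x in b..t, gaussianPDFReal 0 1 x := by
    rw [gaussianTail_eq_integral, gaussianTail_eq_integral,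
      intervalIntegral.integral_Ioi_sub_Ioi' hint.integrableOn hint.integrableOn]
  rw [h, abs_sub_comm b t, ← Real.norm_eq_abs]
  refine intervalIntegral.norm_integral_le_of_norm_le_const fun x hx => ?_
  rw [Real.norm_of_nonneg (gaussianPDFReal_nonneg _ _ _)]
  refine (gaussianPDFReal_le_mul_exp t x).trans ?_
  have hx' : t - x ≤ |t - b| := by
    rcases Set.mem_uIoc.1 hx with h | h
    · exact le_trans (by linarith [h.1]) (le_abs_self _)
    · exact le_trans (by linarith [h.1]) (abs_nonneg _)
  have := gaussianPDFReal_nonneg 0 1 t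
  gcongr

theorem gaussianTail_nonneg (t : ℝ) : 0 ≤ RCNHalfspace.gaussianTail t := measureReal_nonneg

theorem gaussianTail_le_one (t : ℝ) : RCNHalfspace.gaussianTail t ≤ 1 := measureReal_le_one

theorem gaussianTail_le_exp {t : ℝ} (ht : 0 ≤ t) :
    RCNHalfspace.gaussianTail t ≤ Real.exp (-t ^ 2 / 2) := by
  have h := measure_ge_le_exp_mul_mgf (μ := gaussianReal 0 1) (X := id) t ht
    (by simpa using integrable_exp_mul_gaussianReal (μ := 0) (v := 1) t)
  rw [mgf_id_gaussianReal] at h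
  refine (measureReal_mono ?_).trans (h.trans (le_of_eq ?_))
  · exact fun x (hx : t < x) => hx.le
  · rw [← Real.exp_add]; congr 1; simp; ring

/-- A Mills-ratio bound: on `[t, t + 1/(1+t)]` the square grows by at most `3`, so the density stays
above `exp (-3/2)` times its value at `t`. It later converts squared densities into `p²`. -/
theorem gaussianPDFReal_le_gaussianTail {t : ℝ} (ht : 0 ≤ t) :
    gaussianPDFReal 0 1 t ≤ Real.exp (3 / 2) * (1 + t) * RCNHalfspace.gaussianTail t := by
  set b := t + 1 / (1 + t) with hb
  have h1t : 0 < 1 + t := by linarith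
  have hfrac : 0 < 1 / (1 + t) := by positivity
  have hfrac1 : 1 / (1 + t) ≤ 1 := by rw [div_le_one h1t]; linarith
  have hfract : t * (1 / (1 + t)) ≤ 1 := by
    rw [mul_one_div, div_le_one h1t]; linarith
  have hint := integrable_gaussianPDFReal 0 1
  have h : RCNHalfspace.gaussianTail t - RCNHalfspace.gaussianTail b =
      ∫ x in t..b, gaussianPDFReal 0 1 x := by
    rw [gaussianTail_eq_integral, gaussianTail_eq_integral,
      intervalIntegral.integral_Ioi_sub_Ioi' hint.integrableOn hint.integrableOn]
  have hlow : ∫ _ in t..b, gaussianPDFReal 0 1 t * Real.exp (-(3 / 2)) ≤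
      ∫ x in t..b, gaussianPDFReal 0 1 x := by
    refine intervalIntegral.integral_mono_on (by linarith) (by simp) hint.intervalIntegrable ?_
    intro x hx
    rw [gaussianPDFReal_zero_one, gaussianPDFReal_zero_one, mul_assoc, ← Real.exp_add]
    gcongr
    have hx2 : x ^ 2 ≤ b ^ 2 := by
      have := hx.1; have := hx.2
      gcongr
      linarith
    have : b ^ 2 ≤ t ^ 2 + 3 := by
      rw [hb]; nlinarith
    linarith
  rw [intervalIntegral.integral_const, smul_eq_mul, ← h] at hlow
  have hb0 := gaussianTail_nonneg b
  have h3 : 1 / (1 + t) * (gaussianPDFReal 0 1 t * Real.exp (-(3 / 2))) ≤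
      RCNHalfspace.gaussianTail t := by
    have : b - t = 1 / (1 + t) := by rw [hb]; ring
    rw [this] at hlow; linarith
  calc gaussianPDFReal 0 1 t = Real.exp (3 / 2) * (1 + t) *
        (1 / (1 + t) * (gaussianPDFReal 0 1 t * Real.exp (-(3 / 2)))) := by
        rw [Real.exp_neg]; field_simp
    _ ≤ _ := by gcongr

/-- The function `(x - l) exp (l x) φ(x)` has the explicit antiderivative `-exp (l x) φ(x)`, and `x
≤ 2 (x - l)` beyond `t` because `2 l ≤ t`. -/
theorem integral_Ioi_mul_exp_mul_gaussianPDFReal_le {t l : ℝ} (ht : 0 ≤ t) (hl : 2 * l ≤ t) :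
    IntegrableOn (fun x => x * Real.exp (l * x) * gaussianPDFReal 0 1 x) (Set.Ioi t) ∧
    ∫ x in Set.Ioi t, x * Real.exp (l * x) * gaussianPDFReal 0 1 x ≤
      2 * (Real.exp (l * t) * gaussianPDFReal 0 1 t) := by
  set F : ℝ → ℝ := fun x => -(Real.exp (l * x) * gaussianPDFReal 0 1 x) with hF
  have hderiv : ∀ x, HasDerivAt F ((x - l) * (Real.exp (l * x) * gaussianPDFReal 0 1 x)) x := by
    intro x
    have h1 : F = fun x => -((Real.sqrt (2 * Real.pi))⁻¹ * Real.exp (l * x - x ^ 2 / 2)) := by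
      ext y
      rw [hF]; simp only [gaussianPDFReal_zero_one]
      rw [show l * y - y ^ 2 / 2 = l * y + -y ^ 2 / 2 by ring, Real.exp_add]; ring
    have h2 : HasDerivAt (fun x : ℝ => l * x - x ^ 2 / 2) (l - x) x := by
      have := ((hasDerivAt_id x).const_mul l).sub (((hasDerivAt_id x).pow 2).div_const 2)
      refine this.congr_deriv ?_
      simp
    rw [h1]
    refine ((h2.exp.const_mul _).neg).congr_deriv ?_
    rw [gaussianPDFReal_zero_one, show l * x - x ^ 2 / 2 = l * x + -x ^ 2 / 2 by ring, Real.exp_add]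
    ring
  have hlim : Filter.Tendsto F Filter.atTop (nhds 0) := by
    have h1 : F = fun x => -((Real.sqrt (2 * Real.pi))⁻¹ * Real.exp (l * x - x ^ 2 / 2)) := by
      ext y
      rw [hF]; simp only [gaussianPDFReal_zero_one]
      rw [show l * y - y ^ 2 / 2 = l * y + -y ^ 2 / 2 by ring, Real.exp_add]; ring
    rw [h1]
    have h2 : Filter.Tendsto (fun x : ℝ => l * x - x ^ 2 / 2) Filter.atTop Filter.atBot := by
      have h3 : Filter.Tendsto (fun x : ℝ => x * (x / 2 - l)) Filter.atTop Filter.atTop := by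
        refine Filter.tendsto_id.atTop_mul_atTop₀ ?_
        exact Filter.tendsto_atTop_add_const_right _ _
          (Filter.tendsto_id.atTop_div_const (by norm_num))
      refine (Filter.tendsto_neg_atTop_atBot.comp h3).congr fun x => ?_
      simp only [Function.comp]; ring
    have := ((Real.tendsto_exp_atBot.comp h2).const_mul (Real.sqrt (2 * Real.pi))⁻¹).neg
    simpa using this
  have hpos : ∀ x ∈ Set.Ioi t, 0 ≤ (x - l) * (Real.exp (l * x) * gaussianPDFReal 0 1 x) := by
    intro x hx
    have := gaussianPDFReal_nonneg 0 1 x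
    have hx' : t < x := hx
    have : 0 ≤ x - l := by linarith
    positivity
  have hI := integrableOn_Ioi_deriv_of_nonneg' (fun x _ => hderiv x) hpos hlim
  have hV := integral_Ioi_of_hasDerivAt_of_nonneg' (fun x _ => hderiv x) hpos hlim
  have hle : ∀ x ∈ Set.Ioi t, ‖x * Real.exp (l * x) * gaussianPDFReal 0 1 x‖ ≤
      2 * ((x - l) * (Real.exp (l * x) * gaussianPDFReal 0 1 x)) := by
    intro x hx
    have hφ := gaussianPDFReal_nonneg 0 1 x
    have hx' : t < x := hx
    have hx0 : 0 ≤ x := by linarith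
    rw [Real.norm_of_nonneg (by positivity), mul_assoc, ← mul_assoc 2]
    gcongr
    linarith
  have hI2 : IntegrableOn (fun x => x * Real.exp (l * x) * gaussianPDFReal 0 1 x) (Set.Ioi t) := by
    refine Integrable.mono' (hI.const_mul 2) ?_ ?_
    · exact (((measurable_id.mul (by fun_prop)).mul
        (measurable_gaussianPDFReal 0 1))).aestronglyMeasurable
    · exact (ae_restrict_iff' measurableSet_Ioi).2 (Filter.Eventually.of_forall hle)
  refine ⟨hI2, ?_⟩
  calc _ ≤ ∫ x in Set.Ioi t, 2 * ((x - l) * (Real.exp (l * x) * gaussianPDFReal 0 1 x)) :=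
        setIntegral_mono_on hI2 (hI.const_mul 2) measurableSet_Ioi
          fun x hx => (le_abs_self _).trans (hle x hx)
    _ = _ := by rw [integral_const_mul, hV, hF]; ring

/-! ### Two halfspaces under the standard Gaussian law -/

section
variable {E : Type*} [NormedAddCommGroup E] [InnerProductSpace ℝ E] [FiniteDimensional ℝ E]
  [MeasurableSpace E] [BorelSpace E]

theorem map_inner_stdGaussian {u : E} (hu : ‖u‖ = 1) :
    (stdGaussian E).map (fun x => inner ℝ u x) = gaussianReal 0 1 := by
  have h := (IsGaussian.hasGaussianLaw_id (μ := stdGaussian E)).map_fun (innerSL ℝ u)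
  have h2 := h.map_eq_gaussianReal
  have h3 := integral_strongDual_stdGaussian (innerSL ℝ u)
  have h4 := variance_dual_stdGaussian (innerSL ℝ u)
  simp only [id, innerSL_apply_norm, hu] at h2 h3 h4
  rw [h3, h4] at h2
  simpa using h2

/-- Orthogonal directions are uncorrelated, and jointly Gaussian uncorrelated variables are
independent. -/
theorem map_inner_pair_stdGaussian {u w : E} (hu : ‖u‖ = 1) (hw : ‖w‖ = 1)
    (huw : inner ℝ u w = 0) :
    (stdGaussian E).map (fun x => (inner ℝ u x, inner ℝ w x)) =
      (gaussianReal 0 1).prod (gaussianReal 0 1) := by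
  have h := (IsGaussian.hasGaussianLaw_id (μ := stdGaussian E)).map_fun
    ((innerSL ℝ u).prod (innerSL ℝ w))
  have hc : cov[fun x => inner ℝ u x, fun x => inner ℝ w x; stdGaussian E] = 0 := by
    rw [← covarianceBilin_apply_eq_cov IsGaussian.memLp_two_id, covarianceBilin_stdGaussian]
    simpa [innerSL_apply_apply ℝ] using huw
  have hi : IndepFun (fun x => inner ℝ u x) (fun x => inner ℝ w x) (stdGaussian E) :=
    HasGaussianLaw.indepFun_of_covariance_eq_zero h hc
  rw [(indepFun_iff_map_prod_eq_prod_map_map (by fun_prop) (by fun_prop)).1 hi,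
    map_inner_stdGaussian hu, map_inner_stdGaussian hw]

end

namespace RCNHalfspace
variable {d : ℕ}

theorem halfspaceInd_eq_indicator (t : ℝ) (v x : EuclideanSpace ℝ (Fin d)) :
    halfspaceInd t v x = (Set.Ioi t).indicator 1 (inner ℝ v x) := by
  simp [halfspaceInd, Set.indicator_apply, sub_pos]

theorem halfspaceInd_nonneg (t : ℝ) (v x : EuclideanSpace ℝ (Fin d)) : 0 ≤ halfspaceInd t v x := by
  unfold halfspaceInd; split_ifs <;> norm_num

theorem halfspaceInd_le_one (t : ℝ) (v x : EuclideanSpace ℝ (Fin d)) : halfspaceInd t v x ≤ 1 := by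
  unfold halfspaceInd; split_ifs <;> norm_num

theorem measurable_halfspaceInd (t : ℝ) (v : EuclideanSpace ℝ (Fin d)) :
    Measurable (halfspaceInd t v) := by
  have : halfspaceInd t v = fun x => (Set.Ioi t).indicator (1 : ℝ → ℝ) (inner ℝ v x) :=
    funext fun x => halfspaceInd_eq_indicator t v x
  rw [this]
  exact (measurable_one.indicator measurableSet_Ioi).comp (by fun_prop)

theorem integral_halfspaceInd (t : ℝ) {v : EuclideanSpace ℝ (Fin d)} (hv : ‖v‖ = 1) :
    ∫ x, halfspaceInd t v x ∂stdGaussian (EuclideanSpace ℝ (Fin d)) = gaussianTail t := by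
  simp_rw [halfspaceInd_eq_indicator]
  rw [← integral_map (φ := fun x => inner ℝ v x)
      (f := fun y => (Set.Ioi t).indicator (1 : ℝ → ℝ) y) (by fun_prop)
      (measurable_one.indicator measurableSet_Ioi).aestronglyMeasurable,
    map_inner_stdGaussian hv, integral_indicator_one measurableSet_Ioi, gaussianTail]

theorem integrable_halfspaceInd (t : ℝ) (v : EuclideanSpace ℝ (Fin d)) :
    Integrable (halfspaceInd t v) (stdGaussian (EuclideanSpace ℝ (Fin d))) :=
  Integrable.of_bound (measurable_halfspaceInd t v).aestronglyMeasurable 1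
    (Filter.Eventually.of_forall fun x => by
      rw [Real.norm_of_nonneg (halfspaceInd_nonneg t v x)]; exact halfspaceInd_le_one t v x)

theorem integrable_halfspaceInd_mul (t : ℝ) (v u : EuclideanSpace ℝ (Fin d)) :
    Integrable (fun x => halfspaceInd t v x * halfspaceInd t u x)
      (stdGaussian (EuclideanSpace ℝ (Fin d))) :=
  (integrable_halfspaceInd t u).bdd_mul (c := 1)
    (measurable_halfspaceInd t v).aestronglyMeasurable
    (Filter.Eventually.of_forall fun x => by
      rw [Real.norm_of_nonneg (halfspaceInd_nonneg t v x)]; exact halfspaceInd_le_one t v x)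

theorem measurable_gaussianTail : Measurable gaussianTail := by
  have : Antitone gaussianTail := fun a b hab => measureReal_mono (Set.Ioi_subset_Ioi hab)
  exact this.measurable

/-- The covariance of two halfspaces with the same threshold, by conditioning on the first of the
two coordinates. -/
theorem integral_halfspaceInd_mul {u v : EuclideanSpace ℝ (Fin d)} (hu : ‖u‖ = 1) (hv : ‖v‖ = 1)
    (t : ℝ) (hs : |(inner ℝ u v : ℝ)| < 1) :
    ∫ x, halfspaceInd t u x * halfspaceInd t v x ∂stdGaussian (EuclideanSpace ℝ (Fin d)) =
      ∫ x in Set.Ioi t, gaussianTail ((t - inner ℝ u v * x) / Real.sqrt (1 - (inner ℝ u v) ^ 2))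
        ∂gaussianReal 0 1 := by
  set s : ℝ := inner ℝ u v with hsdef
  set q := Real.sqrt (1 - s ^ 2) with hq
  have hs2 : 0 < 1 - s ^ 2 := by
    have := (sq_lt_one_iff_abs_lt_one s).2 hs
    linarith
  have hq0 : 0 < q := Real.sqrt_pos.2 hs2
  have hq2 : q ^ 2 = 1 - s ^ 2 := Real.sq_sqrt hs2.le
  -- Gram–Schmidt: `v = s u + q w` with `w` a unit vector orthogonal to `u`, so given the
  -- `u`-coordinate `x` the second halfspace is a tail event for the independent `w`-coordinate.
  set w : EuclideanSpace ℝ (Fin d) := q⁻¹ • (v - s • u) with hw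
  have huw : inner ℝ u w = 0 := by
    rw [hw, inner_smul_right, inner_sub_right, inner_smul_right, real_inner_self_eq_norm_sq, hu,
      ← hsdef]; simp
  have hw1 : ‖w‖ = 1 := by
    have : ‖v - s • u‖ ^ 2 = q ^ 2 := by
      rw [norm_sub_sq_real, inner_smul_right, real_inner_comm, ← hsdef, norm_smul, hu, hv, hq2,
        Real.norm_eq_abs, mul_one, sq_abs]
      ring
    have h2 : ‖v - s • u‖ = q := by
      rwa [sq_eq_sq₀ (norm_nonneg _) hq0.le] at this
    rw [hw, norm_smul, h2, norm_inv, Real.norm_of_nonneg hq0.le, inv_mul_cancel₀ hq0.ne']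
  have hvx : ∀ x, inner ℝ v x = s * inner ℝ u x + q * inner ℝ w x := by
    intro x
    rw [hw, real_inner_smul_left, inner_sub_left, real_inner_smul_left, ← mul_assoc,
      mul_inv_cancel₀ hq0.ne']
    ring
  set A : Set (ℝ × ℝ) := {z | t < z.1 ∧ t < s * z.1 + q * z.2} with hA
  have hAm : MeasurableSet A :=
    (measurableSet_lt (f := fun _ : ℝ × ℝ => t) (g := fun z : ℝ × ℝ => z.1) measurable_const
      (by fun_prop)).inter
      (measurableSet_lt (f := fun _ : ℝ × ℝ => t) (g := fun z : ℝ × ℝ => s * z.1 + q * z.2)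
        measurable_const (by fun_prop))
  have h1 : ∀ x, halfspaceInd t u x * halfspaceInd t v x =
      A.indicator (1 : ℝ × ℝ → ℝ) (inner ℝ u x, inner ℝ w x) := by
    intro x
    rw [halfspaceInd_eq_indicator, halfspaceInd_eq_indicator, hvx]
    simp only [Set.indicator_apply, Set.mem_Ioi, hA, Set.mem_ofPred_eq, Pi.one_apply]
    by_cases h1 : t < inner ℝ u x <;>
      by_cases h2 : t < s * inner ℝ u x + q * inner ℝ w x <;> simp [h1, h2]
  simp_rw [h1]
  rw [← integral_map (φ := fun x => ((inner ℝ u x : ℝ), (inner ℝ w x : ℝ)))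
      (f := fun y => A.indicator (1 : ℝ × ℝ → ℝ) y) (by fun_prop)
      (measurable_one.indicator hAm).aestronglyMeasurable,
    map_inner_pair_stdGaussian hu hw1 huw, integral_prod _
      ((integrable_indicator_iff hAm).2 (integrable_const _).integrableOn),
    ← integral_indicator measurableSet_Ioi]
  congr 1
  ext x
  by_cases hx : t < x
  · rw [Set.indicator_of_mem (by exact hx), gaussianTail, ← integral_indicator_one measurableSet_Ioi]
    congr 1
    ext y
    simp only [Set.indicator_apply, hA, Set.mem_ofPred_eq, Set.mem_Ioi, div_lt_iff₀ hq0]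
    congr 1
    refine propext ⟨fun h => by linarith [h.2], fun h => ⟨hx, by linarith⟩⟩
  · rw [Set.indicator_of_notMem (by exact hx)]
    simp [hA, hx]

/-- Given the first coordinate `x > t`, correlation only moves the threshold of the second halfspace
from `t` to `(t - s x)/q`. The change of tail supplies one factor `φ(t)` and the integral over `x >
t` the other; the product `φ(t)²` keeps the error proportional to `p²` up to `(1+t)²`. -/
theorem abs_integral_halfspaceInd_mul_sub_le {u v : EuclideanSpace ℝ (Fin d)} (hu : ‖u‖ = 1)
    (hv : ‖v‖ = 1) {t : ℝ} (ht : 0 ≤ t) (hs : |(inner ℝ u v : ℝ)| ≤ 1 / 4)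
    (hst : |(inner ℝ u v : ℝ)| * t ^ 2 ≤ 1 / 4) :
    |∫ x, halfspaceInd t u x * halfspaceInd t v x ∂stdGaussian (EuclideanSpace ℝ (Fin d)) -
        gaussianTail t ^ 2| ≤
      4 * Real.exp (1 / 2) * |(inner ℝ u v : ℝ)| * gaussianPDFReal 0 1 t ^ 2 := by
  rw [integral_halfspaceInd_mul hu hv t (by linarith)]
  set s : ℝ := inner ℝ u v with hsdef
  set q := Real.sqrt (1 - s ^ 2) with hq
  have hs2 : s ^ 2 ≤ 1 / 16 := by rw [← sq_abs]; nlinarith [abs_nonneg s]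
  have hq2 : q ^ 2 = 1 - s ^ 2 := Real.sq_sqrt (by linarith)
  have hq0 : 0 ≤ q := Real.sqrt_nonneg _
  have hq1 : q ≤ 1 := by nlinarith [sq_nonneg s]
  have hq3 : 3 / 4 ≤ q := by nlinarith
  have hqs : 1 - q ≤ s ^ 2 := by nlinarith
  have hconst : gaussianTail t ^ 2 = ∫ _ in Set.Ioi t, gaussianTail t ∂gaussianReal 0 1 := by
    rw [setIntegral_const, smul_eq_mul, ← gaussianTail, sq]
  have hmeas : Measurable fun x => gaussianTail ((t - s * x) / q) :=
    measurable_gaussianTail.comp (by fun_prop)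
  have hint : Integrable (fun x => gaussianTail ((t - s * x) / q)) (gaussianReal 0 1) :=
    Integrable.of_bound hmeas.aestronglyMeasurable 1 (Filter.Eventually.of_forall fun x => by
      rw [Real.norm_of_nonneg (gaussianTail_nonneg _)]; exact gaussianTail_le_one _)
  rw [hconst, ← integral_sub hint.integrableOn (integrable_const _)]
  have hφ := gaussianPDFReal_nonneg 0 1 t
  have hpt : ∀ x ∈ Set.Ioi t, ‖gaussianTail ((t - s * x) / q) - gaussianTail t‖ ≤
      gaussianPDFReal 0 1 t * (2 * |s|) * (x * Real.exp (2 * |s| * t * x)) := by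
    intro x hx
    have hx' : t < x := hx
    have hx0 : 0 ≤ x := by linarith
    -- The rescaling by `q` costs only `1 - q ≤ s² ≤ |s|/4`, and `t < x`; the total `5/4 |s| x` fits
    -- since `q ≥ 3/4`.
    have hb : |(t - s * x) / q - t| ≤ 2 * |s| * x := by
      have : (t - s * x) / q - t = (t * (1 - q) - s * x) / q := by field_simp; ring
      rw [this, abs_div, abs_of_nonneg hq0, div_le_iff₀ (by linarith)]
      calc |t * (1 - q) - s * x| ≤ |t * (1 - q)| + |s * x| := abs_sub _ _
        _ = t * (1 - q) + |s| * x := by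
            rw [abs_mul s, abs_of_nonneg hx0, abs_of_nonneg (mul_nonneg ht (by linarith))]
        _ ≤ x * (|s| / 4) + |s| * x := by
            gcongr
            rw [← sq_abs] at hqs; nlinarith [abs_nonneg s]
        _ ≤ 2 * |s| * x * q := by
            have := mul_nonneg (abs_nonneg s) hx0
            nlinarith
    refine (abs_gaussianTail_sub_le ht).trans ?_
    calc gaussianPDFReal 0 1 t * Real.exp (t * |(t - s * x) / q - t|) * |(t - s * x) / q - t|
        ≤ gaussianPDFReal 0 1 t * Real.exp (t * (2 * |s| * x)) * (2 * |s| * x) := by gcongr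
      _ = _ := by rw [show t * (2 * |s| * x) = 2 * |s| * t * x by ring]; ring
  have hl : 2 * (2 * |s| * t) ≤ t := by nlinarith [abs_nonneg s]
  obtain ⟨hI, hV⟩ := integral_Ioi_mul_exp_mul_gaussianPDFReal_le ht hl
  have hset : ∀ f : ℝ → ℝ, ∫ x in Set.Ioi t, f x ∂gaussianReal 0 1 =
      ∫ x in Set.Ioi t, f x * gaussianPDFReal 0 1 x := by
    intro f
    rw [← integral_indicator measurableSet_Ioi, ← integral_indicator measurableSet_Ioi,
      integral_gaussianReal_eq_integral_smul one_ne_zero]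
    congr 1
    ext x
    by_cases hx : x ∈ Set.Ioi t <;> simp [hx, mul_comm]
  rw [hset, ← Real.norm_eq_abs]
  calc _ ≤ ∫ x in Set.Ioi t, gaussianPDFReal 0 1 t * (2 * |s|) *
          (x * Real.exp (2 * |s| * t * x) * gaussianPDFReal 0 1 x) := by
        refine norm_integral_le_of_norm_le (hI.const_mul _) ?_
        refine (ae_restrict_iff' measurableSet_Ioi).2 (Filter.Eventually.of_forall fun x hx => ?_)
        rw [norm_mul, Real.norm_of_nonneg (gaussianPDFReal_nonneg 0 1 x), ← mul_assoc]
        have := gaussianPDFReal_nonneg 0 1 x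
        gcongr
        exact hpt x hx
    _ = gaussianPDFReal 0 1 t * (2 * |s|) * ∫ x in Set.Ioi t,
          (x * Real.exp (2 * |s| * t * x) * gaussianPDFReal 0 1 x) := integral_const_mul _ _
    _ ≤ gaussianPDFReal 0 1 t * (2 * |s|) *
          (2 * (Real.exp (2 * |s| * t * t) * gaussianPDFReal 0 1 t)) := by gcongr
    _ ≤ gaussianPDFReal 0 1 t * (2 * |s|) *
          (2 * (Real.exp (1 / 2) * gaussianPDFReal 0 1 t)) := by
        gcongr; nlinarith
    _ = _ := by ring

/-- The covariance of two halfspaces of threshold `t` whose normals have a small inner product. -/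
theorem abs_cov_halfspaceInd_le {u v : EuclideanSpace ℝ (Fin d)} (hu : ‖u‖ = 1)
    (hv : ‖v‖ = 1) {t : ℝ} (ht : 0 ≤ t) (hs : |(inner ℝ u v : ℝ)| ≤ 1 / 4)
    (hst : |(inner ℝ u v : ℝ)| * t ^ 2 ≤ 1 / 4) :
    |∫ x, halfspaceInd t u x * halfspaceInd t v x ∂stdGaussian (EuclideanSpace ℝ (Fin d)) -
        gaussianTail t ^ 2| ≤
      4 * Real.exp (7 / 2) * |(inner ℝ u v : ℝ)| * (1 + t) ^ 2 * gaussianTail t ^ 2 := by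
  refine (abs_integral_halfspaceInd_mul_sub_le hu hv ht hs hst).trans ?_
  have h := gaussianPDFReal_le_gaussianTail ht
  have hφ := gaussianPDFReal_nonneg 0 1 t
  calc 4 * Real.exp (1 / 2) * |(inner ℝ u v : ℝ)| * gaussianPDFReal 0 1 t ^ 2
      ≤ 4 * Real.exp (1 / 2) * |(inner ℝ u v : ℝ)| *
        (Real.exp (3 / 2) * (1 + t) * gaussianTail t) ^ 2 := by gcongr
    _ = _ := by
      rw [show (7 / 2 : ℝ) = 1 / 2 + 3 / 2 + 3 / 2 by norm_num, Real.exp_add, Real.exp_add]; ring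

end RCNHalfspace

/-! ### Nearly orthogonal subsets of the hypercube -/

/-- Greedy selection: some candidate has total penalty at most `m N` against the `N` points already
chosen. As `m N < W`, each single penalty is below `W`, which also makes the candidate new because
self-penalties are at least `W`. The ordered-pair sum grows by at most `2 m N ≤ m ((N+1)² - N²)`. -/
theorem exists_finset_of_average_le {B V : Type*} [Fintype B] [Nonempty B] [DecidableEq V]
    (e : B → V) (Ψ : V → V → ℝ) (m W : ℝ) (hsymm : ∀ u v, Ψ u v = Ψ v u) (hpos : ∀ u v, 0 ≤ Ψ u v)
    (hm : ∀ a, ∑ b, Ψ (e a) (e b) ≤ m * Fintype.card B) (hW : ∀ a, W ≤ Ψ (e a) (e a))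
    (N : ℕ) (hN : N * m < W) :
    ∃ S : Finset V, (∀ v ∈ S, v ∈ Set.range e) ∧ S.card = N ∧
      (∀ u ∈ S, ∀ v ∈ S, u ≠ v → Ψ u v < W) ∧
      ∑ u ∈ S, ∑ v ∈ S, (if u = v then 0 else Ψ u v) ≤ m * N ^ 2 := by
  have hcard : (0 : ℝ) < Fintype.card B := by exact_mod_cast Fintype.card_pos
  have hm0 : 0 ≤ m := by
    have h := (Finset.sum_nonneg fun b _ => hpos (e (Classical.arbitrary B)) (e b)).trans
      (hm (Classical.arbitrary B))
    exact nonneg_of_mul_nonneg_left h hcard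
  induction N with
  | zero => exact ⟨∅, by simp, by simp, by simp, by simp⟩
  | succ N ih =>
    push_cast at hN ⊢
    obtain ⟨S, hS, hSc, hSW, hSsum⟩ := ih (by linarith)
    have havg : ∑ b, ∑ u ∈ S, Ψ u (e b) ≤ ∑ _b : B, m * N := by
      rw [Finset.sum_comm, Finset.sum_const, Finset.card_univ, nsmul_eq_mul]
      calc ∑ u ∈ S, ∑ b, Ψ u (e b) ≤ ∑ u ∈ S, m * Fintype.card B := by
            refine Finset.sum_le_sum fun u hu => ?_
            obtain ⟨a, rfl⟩ := hS u hu
            exact hm a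
        _ = _ := by rw [Finset.sum_const, hSc, nsmul_eq_mul]; ring
    obtain ⟨b, -, hb⟩ := Finset.exists_le_of_sum_le Finset.univ_nonempty havg
    have hlt : ∀ u ∈ S, Ψ u (e b) < W := fun u hu =>
      ((Finset.single_le_sum (fun u _ => hpos u (e b)) hu).trans hb).trans_lt (by linarith)
    have hbS : e b ∉ S := fun h => absurd (hlt _ h) (not_lt.2 (hW b))
    refine ⟨insert (e b) S, ?_, by rw [Finset.card_insert_of_notMem hbS, hSc], ?_, ?_⟩
    · intro v hv
      rcases Finset.mem_insert.1 hv with rfl | hv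
      exacts [⟨b, rfl⟩, hS v hv]
    · intro u hu v hv huv
      rcases Finset.mem_insert.1 hu with rfl | hu <;> rcases Finset.mem_insert.1 hv with rfl | hv
      · exact absurd rfl huv
      · rw [hsymm]; exact hlt v hv
      · exact hlt u hu
      · exact hSW u hu v hv huv
    · rw [Finset.sum_insert hbS, Finset.sum_insert hbS, if_pos rfl]
      have h1 : ∑ v ∈ S, (if e b = v then 0 else Ψ (e b) v) = ∑ u ∈ S, Ψ u (e b) := by
        refine Finset.sum_congr rfl fun v hv => ?_
        rw [if_neg (fun h : e b = v => hbS (h ▸ hv)), hsymm]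
      have h2 : ∑ u ∈ S, ∑ v ∈ insert (e b) S, (if u = v then 0 else Ψ u v) =
          ∑ u ∈ S, Ψ u (e b) + ∑ u ∈ S, ∑ v ∈ S, (if u = v then 0 else Ψ u v) := by
        rw [← Finset.sum_add_distrib]
        refine Finset.sum_congr rfl fun u hu => ?_
        rw [Finset.sum_insert hbS, if_neg (fun h : u = e b => hbS (h ▸ hu))]
      rw [h1, h2]
      nlinarith

/-! ### Exponential moments of inner products of cube vertices. -/

/-- The sign `±1` of a Boolean. -/
def boolSign (b : Bool) : ℝ := if b then 1 else -1

theorem boolSign_mul_self (b : Bool) : boolSign b * boolSign b = 1 := by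
  cases b <;> simp [boolSign]

theorem sum_exp_sum_mul_boolSign {ι : Type*} [Fintype ι] [DecidableEq ι] (x : ι → ℝ) :
    ∑ b : ι → Bool, Real.exp (∑ i, x i * boolSign (b i)) = ∏ i, (2 * Real.cosh (x i)) := by
  have h : ∀ i, 2 * Real.cosh (x i) = ∑ b : Bool, Real.exp (x i * boolSign b) := by
    intro i
    simp [boolSign, Real.cosh_eq]
    ring
  simp_rw [h, Finset.prod_univ_sum, Fintype.piFinset_univ, Real.exp_sum]

theorem sum_cosh_sum_mul_boolSign {ι : Type*} [Fintype ι] [DecidableEq ι] (x : ι → ℝ) :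
    ∑ b : ι → Bool, Real.cosh (∑ i, x i * boolSign (b i)) = ∏ i, (2 * Real.cosh (x i)) := by
  have h1 := sum_exp_sum_mul_boolSign x
  have h2 := sum_exp_sum_mul_boolSign fun i => -x i
  simp only [Real.cosh_neg, neg_mul, Finset.sum_neg_distrib] at h2
  simp_rw [Real.cosh_eq, ← Finset.sum_div, Finset.sum_add_distrib]
  simp_rw [← Real.cosh_eq]
  rw [h1, h2]; ring

/-- The vertex of the cube `{±1/√d}^d` with the given signs. -/
noncomputable def cubeVector {d : ℕ} (b : Fin d → Bool) : EuclideanSpace ℝ (Fin d) :=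
  WithLp.toLp 2 fun i => boolSign (b i) / Real.sqrt d

theorem inner_cubeVector {d : ℕ} (a b : Fin d → Bool) :
    inner ℝ (cubeVector a) (cubeVector b) = ∑ i, boolSign (a i) * boolSign (b i) / d := by
  rw [PiLp.inner_apply]
  refine Finset.sum_congr rfl fun i _ => ?_
  simp only [cubeVector, RCLike.inner_apply, conj_trivial]
  rw [div_mul_div_comm, Real.mul_self_sqrt (Nat.cast_nonneg d), mul_comm]

theorem inner_cubeVector_self {d : ℕ} (hd : 0 < d) (a : Fin d → Bool) :
    inner ℝ (cubeVector a) (cubeVector a) = (1 : ℝ) := by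
  rw [inner_cubeVector]
  simp only [boolSign_mul_self, Finset.sum_const, Finset.card_univ, Fintype.card_fin, nsmul_eq_mul]
  field_simp

theorem norm_cubeVector {d : ℕ} (hd : 0 < d) (a : Fin d → Bool) : ‖cubeVector a‖ = 1 := by
  have h := inner_cubeVector_self hd a
  rw [real_inner_self_eq_norm_sq] at h
  nlinarith [norm_nonneg (cubeVector a)]

/-- For uniform `b`, `√d` times the inner product is a normalised sum of independent signs, and
`cosh x ≤ exp (x²/2)` makes it sub-Gaussian with variance proxy `1`. -/
theorem sum_cosh_inner_cubeVector_le {d : ℕ} (hd : 0 < d) (θ : ℝ) (a : Fin d → Bool) :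
    ∑ b, Real.cosh (θ * (Real.sqrt d * inner ℝ (cubeVector a) (cubeVector b))) ≤
      Real.exp (θ ^ 2 / 2) * Fintype.card (Fin d → Bool) := by
  have hd' : (0 : ℝ) < d := by exact_mod_cast hd
  have hs : 0 < Real.sqrt d := Real.sqrt_pos.2 hd'
  have h : ∀ b : Fin d → Bool, θ * (Real.sqrt d * inner ℝ (cubeVector a) (cubeVector b)) =
      ∑ i, (θ * boolSign (a i) / Real.sqrt d) * boolSign (b i) := by
    intro b
    rw [inner_cubeVector, Finset.mul_sum, Finset.mul_sum]
    refine Finset.sum_congr rfl fun i _ => ?_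
    have : (d : ℝ) = Real.sqrt d * Real.sqrt d := (Real.mul_self_sqrt hd'.le).symm
    rw [this, Real.sqrt_mul_self hs.le]
    field_simp
  simp_rw [h]
  rw [sum_cosh_sum_mul_boolSign, Finset.prod_mul_distrib, mul_comm]
  have hcosh : ∀ i, Real.cosh (θ * boolSign (a i) / Real.sqrt d) ≤ Real.exp (θ ^ 2 / (2 * d)) := by
    intro i
    refine (Real.cosh_le_exp_half_sq _).trans (le_of_eq ?_)
    rw [div_pow, mul_pow, sq (boolSign _), boolSign_mul_self, Real.sq_sqrt hd'.le]
    congr 1; field_simp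
  have hprod : ∏ i : Fin d, Real.cosh (θ * boolSign (a i) / Real.sqrt d) ≤
      Real.exp (θ ^ 2 / 2) := by
    refine (Finset.prod_le_prod (fun i _ => (Real.cosh_pos _).le) fun i _ => hcosh i).trans
      (le_of_eq ?_)
    rw [Finset.prod_const, Finset.card_univ, Fintype.card_fin, ← Real.exp_nat_mul]
    congr 1; field_simp
  have hcard : ∏ _i : Fin d, (2 : ℝ) = Fintype.card (Fin d → Bool) := by simp
  rw [hcard]
  gcongr

theorem RCNHalfspace.exists_nearlyOrthogonal {d : ℕ} (hd : 0 < d) {c : ℝ} (hc : c ≤ 1 / 2) (N : ℕ)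
    (hN : 3 * (N : ℝ) < Real.exp (((d : ℝ) ^ c) ^ 2 / 2) / 2) :
    ∃ S : Finset (EuclideanSpace ℝ (Fin d)), NearlyOrthogonal c S ∧ S.card = N ∧
      ∑ u ∈ S, ∑ v ∈ S, (if u = v then 0 else Real.cosh (Real.sqrt d * inner ℝ u v)) ≤
        3 * (N : ℝ) ^ 2 := by
  classical
  have hd' : (1 : ℝ) ≤ d := by exact_mod_cast hd
  set θ : ℝ := (d : ℝ) ^ c with hθ
  have hθ0 : 0 < θ := Real.rpow_pos_of_pos (by linarith) _
  have hθd : θ ≤ Real.sqrt d := by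
    rw [Real.sqrt_eq_rpow]; exact Real.rpow_le_rpow_of_exponent_le hd' hc
  have hτ : (d : ℝ) ^ (-(1 / 2 : ℝ) + c) = θ / Real.sqrt d := by
    rw [Real.rpow_add (by linarith), Real.rpow_neg (by linarith), ← Real.sqrt_eq_rpow, ← hθ]; field_simp
  have hs : 0 < Real.sqrt d := Real.sqrt_pos.2 (by linarith)
  set W := Real.exp (θ ^ 2 / 2) / 2 with hW
  -- The first summand is the quantity to be kept small on average. The second has mean at most `1`
  -- but reaches `W` once `|u·v| ≥ θ/√d`, so excluding penalties `≥ W` enforces near-orthogonality.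
  set Ψ : EuclideanSpace ℝ (Fin d) → EuclideanSpace ℝ (Fin d) → ℝ := fun u v =>
    Real.cosh (Real.sqrt d * inner ℝ u v) +
      Real.exp (-(θ ^ 2 / 2)) * Real.cosh (θ * (Real.sqrt d * inner ℝ u v)) with hΨ
  have hbad : ∀ u v : EuclideanSpace ℝ (Fin d), θ / Real.sqrt d ≤ |inner ℝ u v| → W ≤ Ψ u v := by
    intro u v h
    rw [div_le_iff₀ hs] at h
    have h1 : θ ^ 2 ≤ |θ * (Real.sqrt d * inner ℝ u v)| := by
      rw [abs_mul, abs_mul, abs_of_pos hθ0, abs_of_pos hs, sq]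
      gcongr; linarith
    have h2 : Real.exp (θ ^ 2) / 2 ≤ Real.cosh (θ * (Real.sqrt d * inner ℝ u v)) := by
      rw [← Real.cosh_abs, Real.cosh_eq]
      have := Real.exp_le_exp.2 h1
      have := Real.exp_pos (-|θ * (Real.sqrt d * inner ℝ u v)|)
      linarith
    have h3 : W = Real.exp (-(θ ^ 2 / 2)) * (Real.exp (θ ^ 2) / 2) := by
      rw [hW, ← mul_div_assoc, ← Real.exp_add]; ring_nf
    rw [h3]
    have := Real.cosh_pos (Real.sqrt d * inner ℝ u v)
    refine (mul_le_mul_of_nonneg_left h2 (Real.exp_pos _).le).trans ?_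
    simp only [hΨ]; linarith
  have hmean : ∀ a : Fin d → Bool, ∑ b, Ψ (cubeVector a) (cubeVector b) ≤
      3 * Fintype.card (Fin d → Bool) := by
    intro a
    have h1 := sum_cosh_inner_cubeVector_le hd 1 a
    have h2 := mul_le_mul_of_nonneg_left (sum_cosh_inner_cubeVector_le hd θ a)
      (Real.exp_pos (-(θ ^ 2 / 2))).le
    rw [← mul_assoc, ← Real.exp_add, neg_add_cancel, Real.exp_zero, Finset.mul_sum] at h2
    simp only [one_mul] at h1
    have h3 : Real.exp (1 ^ 2 / 2) ≤ 2 := by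
      have h4 : Real.exp (1 ^ 2 / 2) ^ 2 = Real.exp 1 := by
        rw [← Real.exp_nat_mul]; norm_num
      nlinarith [Real.exp_one_lt_d9, Real.exp_pos (1 ^ 2 / 2)]
    have h5 : (0 : ℝ) ≤ Fintype.card (Fin d → Bool) := Nat.cast_nonneg _
    simp only [hΨ, Finset.sum_add_distrib]
    nlinarith
  obtain ⟨S, hSr, hSc, hSW, hsum⟩ := exists_finset_of_average_le (cubeVector (d := d)) Ψ 3 W
    (fun u v => by simp only [hΨ, real_inner_comm])
    (fun u v => by
      have := Real.cosh_pos (Real.sqrt d * inner ℝ u v)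
      have := Real.cosh_pos (θ * (Real.sqrt d * inner ℝ u v))
      positivity) hmean
    (fun a => hbad _ _ (by
      rw [inner_cubeVector_self hd, abs_one, div_le_one hs]; exact hθd)) N (by linarith)
  refine ⟨S, ⟨fun v hv => ?_, fun v hv u hu hvu => ?_⟩, hSc, ?_⟩
  · obtain ⟨a, rfl⟩ := hSr v hv
    exact norm_cubeVector hd a
  · rw [hτ]
    by_contra! h
    exact absurd (hSW v hv u hu hvu) (not_lt.2 (hbad v u h))
  · refine le_trans (Finset.sum_le_sum fun u _ => Finset.sum_le_sum fun v _ => ?_) hsum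
    split_ifs
    · exact le_rfl
    · have := Real.cosh_pos (θ * (Real.sqrt d * inner ℝ u v))
      simp only [hΨ, le_add_iff_nonneg_right]
      positivity

/-! ### Truncated product likelihood ratios -/

section TruncatedProduct

variable {Ω : Type*} [MeasurableSpace Ω] {n : ℕ}

/-- The part of `∏ i, (1 + g (X i)) - 1` formed by the terms with at most `l` factors. -/
def truncatedProduct (n l : ℕ) (g : Ω → ℝ) (X : Fin n → Ω) : ℝ :=
  ∑ T : Finset (Fin n) with T.Nonempty ∧ T.card ≤ l, ∏ i ∈ T, g (X i)

/-- The value of `∫ (truncatedProduct n l g) * (truncatedProduct n l h)` in terms of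
`z = ∫ g * h`. -/
def truncatedPowerSum (n l : ℕ) (z : ℝ) : ℝ :=
  ∑ T : Finset (Fin n) with T.Nonempty ∧ T.card ≤ l, z ^ T.card

/-- For off-diagonal pairs truncation is not needed: the sum over all nonempty `T` is `(1 + |z|)^n -
1`. -/
theorem abs_truncatedPowerSum_le (n l : ℕ) (z : ℝ) :
    |truncatedPowerSum n l z| ≤ Real.exp (n * |z|) - 1 := by
  have h1 : (∑ T : Finset (Fin n), |z| ^ T.card) = (1 + |z|) ^ n := by
    have := Finset.prod_one_add (f := fun _ : Fin n => |z|) Finset.univ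
    simpa using this.symm
  have h2 : ∑ T : Finset (Fin n) with T.Nonempty ∧ T.card ≤ l, |z| ^ T.card ≤
      ∑ T ∈ Finset.univ.erase (∅ : Finset (Fin n)), |z| ^ T.card := by
    refine Finset.sum_le_sum_of_subset_of_nonneg ?_ fun _ _ _ => by positivity
    intro T hT
    simp only [Finset.mem_filter, Finset.mem_univ, true_and] at hT
    simpa using hT.1.ne_empty
  have h3 : (1 + |z|) ^ n ≤ Real.exp (n * |z|) := by
    rw [Real.exp_nat_mul]
    gcongr
    linarith [Real.add_one_le_exp |z|]
  have h4 := Finset.add_sum_erase Finset.univ (fun T : Finset (Fin n) => |z| ^ T.card)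
    (Finset.mem_univ ∅)
  simp only [Finset.card_empty, pow_zero] at h4
  calc |truncatedPowerSum n l z| ≤
        ∑ T : Finset (Fin n) with T.Nonempty ∧ T.card ≤ l, |z| ^ T.card := by
        refine (Finset.abs_sum_le_sum_abs _ _).trans (le_of_eq ?_)
        simp only [abs_pow]
    _ ≤ _ := by linarith

/-- For diagonal pairs `z` is only bounded, and truncation is essential. Taking `n + 1` out of each
of at most `l` factors leaves `(1 + z/(n+1))^n ≤ exp z`; using `n + 1` covers `n = 0` and keeps the
base at least `1`. -/
theorem truncatedPowerSum_le {z : ℝ} (hz : 0 ≤ z) (n l : ℕ) :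
    truncatedPowerSum n l z ≤ ((n : ℝ) + 1) ^ l * Real.exp z := by
  have hn : (0 : ℝ) < (n : ℝ) + 1 := by positivity
  have h1 : (∑ T : Finset (Fin n), (z / (n + 1)) ^ T.card) = (1 + z / (n + 1)) ^ n := by
    have := Finset.prod_one_add (f := fun _ : Fin n => z / (n + 1)) Finset.univ
    simp only [Finset.prod_const, Finset.card_univ, Fintype.card_fin, Finset.powerset_univ] at this
    exact this.symm
  have h2 : (1 + z / (n + 1)) ^ n ≤ Real.exp z := by
    calc (1 + z / (n + 1)) ^ n ≤ (Real.exp (z / (n + 1))) ^ n := by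
          gcongr
          linarith [Real.add_one_le_exp (z / (n + 1))]
      _ = Real.exp (n * (z / (n + 1))) := (Real.exp_nat_mul _ _).symm
      _ ≤ _ := by
          gcongr
          rw [mul_div_assoc', div_le_iff₀ hn]
          nlinarith
  calc truncatedPowerSum n l z
      ≤ ∑ T : Finset (Fin n) with T.Nonempty ∧ T.card ≤ l,
          ((n : ℝ) + 1) ^ l * (z / (n + 1)) ^ T.card := by
        refine Finset.sum_le_sum fun T hT => ?_
        simp only [Finset.mem_filter, Finset.mem_univ, true_and] at hT
        rw [div_pow, mul_div_assoc', le_div_iff₀ (by positivity), mul_comm]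
        gcongr
        · linarith [(Nat.cast_nonneg n : (0 : ℝ) ≤ n)]
        · exact hT.2
    _ ≤ ∑ T : Finset (Fin n), ((n : ℝ) + 1) ^ l * (z / (n + 1)) ^ T.card :=
        Finset.sum_le_sum_of_subset_of_nonneg (Finset.subset_univ _) fun _ _ _ => by positivity
    _ ≤ _ := by rw [← Finset.mul_sum, h1]; gcongr

omit [MeasurableSpace Ω] in
theorem prod_finset_eq_prod_ite (T : Finset (Fin n)) (g : Ω → ℝ) (X : Fin n → Ω) :
    ∏ i ∈ T, g (X i) = ∏ i, (if i ∈ T then g else 1) (X i) := by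
  calc ∏ i ∈ T, g (X i) = ∏ i, if i ∈ T then g (X i) else 1 := by simp
    _ = _ := by
      refine Finset.prod_congr rfl fun i _ => ?_
      split_ifs <;> rfl

variable {μ : Measure Ω} [IsProbabilityMeasure μ]

omit [MeasurableSpace Ω] in
theorem abs_prod_le_of_bound {g : Ω → ℝ} {B : ℝ} (hB : ∀ x, |g x| ≤ B) (T : Finset (Fin n))
    (X : Fin n → Ω) : |∏ i ∈ T, g (X i)| ≤ B ^ T.card := by
  rw [Finset.abs_prod, ← Finset.prod_const]
  exact Finset.prod_le_prod (fun i _ => abs_nonneg _) fun i _ => hB _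

theorem memLp_prod_of_bound {g : Ω → ℝ} (hg : Measurable g) {B : ℝ} (hB : ∀ x, |g x| ≤ B)
    (T : Finset (Fin n)) (p : ℝ≥0∞) :
    MemLp (fun X : Fin n → Ω => ∏ i ∈ T, g (X i)) p (Measure.pi fun _ => μ) :=
  MemLp.of_bound (Finset.measurable_fun_prod _ fun i _ =>
    hg.comp (measurable_pi_apply i)).aestronglyMeasurable (B ^ T.card)
    (Filter.Eventually.of_forall fun X => abs_prod_le_of_bound hB T X)

theorem memLp_truncatedProduct {g : Ω → ℝ} (hg : Measurable g) {B : ℝ} (hB : ∀ x, |g x| ≤ B)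
    (l : ℕ) (p : ℝ≥0∞) :
    MemLp (truncatedProduct n l g) p (Measure.pi fun _ => μ) :=
  memLp_finsetSum _ fun T _ => memLp_prod_of_bound hg hB T p

/-- If `T ≠ U`, some index lies in exactly one of them, and its coordinate integrates a single
mean-zero factor. -/
theorem integral_prod_mul_prod_finset {g h : Ω → ℝ}
    (hg0 : ∫ x, g x ∂μ = 0) (hh0 : ∫ x, h x ∂μ = 0) (T U : Finset (Fin n)) :
    ∫ X : Fin n → Ω, (∏ i ∈ T, g (X i)) * ∏ i ∈ U, h (X i) ∂Measure.pi (fun _ => μ) =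
      if T = U then (∫ x, g x * h x ∂μ) ^ T.card else 0 := by
  simp_rw [prod_finset_eq_prod_ite, ← Finset.prod_mul_distrib]
  rw [integral_fintype_prod_eq_prod
    (f := fun i x => (if i ∈ T then g else 1) x * (if i ∈ U then h else 1) x)]
  split_ifs with hTU
  · subst hTU
    calc _ = ∏ i, if i ∈ T then ∫ x, g x * h x ∂μ else 1 := by
          refine Finset.prod_congr rfl fun i _ => ?_
          split_ifs <;> simp
      _ = _ := by simp
  · obtain ⟨i, hi⟩ : ∃ i, ¬ (i ∈ T ↔ i ∈ U) := by
      by_contra! hcon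
      exact hTU (Finset.ext hcon)
    refine Finset.prod_eq_zero (Finset.mem_univ i) ?_
    by_cases hiT : i ∈ T <;> by_cases hiU : i ∈ U <;> simp_all

theorem integral_truncatedProduct_mul {g h : Ω → ℝ} (hg : Measurable g) (hh : Measurable h)
    {B : ℝ} (hgB : ∀ x, |g x| ≤ B) (hhB : ∀ x, |h x| ≤ B)
    (hg0 : ∫ x, g x ∂μ = 0) (hh0 : ∫ x, h x ∂μ = 0) (l : ℕ) :
    ∫ X : Fin n → Ω, truncatedProduct n l g X * truncatedProduct n l h X
        ∂Measure.pi (fun _ => μ) = truncatedPowerSum n l (∫ x, g x * h x ∂μ) := by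
  unfold truncatedProduct truncatedPowerSum
  simp_rw [Finset.sum_mul_sum]
  have hint : ∀ T U : Finset (Fin n), Integrable
      (fun X : Fin n → Ω => (∏ i ∈ T, g (X i)) * ∏ i ∈ U, h (X i)) (Measure.pi fun _ => μ) :=
    fun T U => (memLp_prod_of_bound hg hgB T 2).integrable_mul (memLp_prod_of_bound hh hhB U 2)
  rw [integral_finsetSum _ fun T _ => integrable_finsetSum _ fun U _ => hint T U]
  refine Finset.sum_congr rfl fun T hT => ?_
  rw [integral_finsetSum _ fun U _ => hint T U]
  simp_rw [integral_prod_mul_prod_finset hg0 hh0]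
  rw [Finset.sum_ite_eq, if_pos hT]

/-- A product of functions of at most `l` of the variables does not distinguish the full product
`∏ i, (1 + g (X i))` from its truncation. -/
theorem integral_prod_mul_sub_truncatedProduct {g : Ω → ℝ} (hg : Measurable g) {B : ℝ}
    (hgB : ∀ x, |g x| ≤ B) (hg0 : ∫ x, g x ∂μ = 0) {l : ℕ} (m : Fin n → Ω → ℝ)
    (hm : ∀ i, Integrable (m i) μ) (U : Finset (Fin n)) (hU : U.card ≤ l)
    (hmU : ∀ i ∉ U, m i = 1) :
    ∫ X : Fin n → Ω, (∏ i, m i (X i)) *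
      (∏ i, (1 + g (X i)) - (1 + truncatedProduct n l g X)) ∂Measure.pi (fun _ => μ) = 0 := by
  have hsplit : ∀ X : Fin n → Ω, ∏ i, (1 + g (X i)) - (1 + truncatedProduct n l g X) =
      ∑ T : Finset (Fin n) with l < T.card, ∏ i ∈ T, g (X i) := by
    intro X
    have h1 : ∏ i, (1 + g (X i)) = ∑ T : Finset (Fin n), ∏ i ∈ T, g (X i) := by
      rw [Finset.prod_one_add]; simp
    rw [h1, ← Finset.sum_filter_add_sum_filter_not Finset.univ
      (fun T : Finset (Fin n) => l < T.card),
      ← Finset.sum_filter_add_sum_filter_not (Finset.univ.filter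
        (fun T : Finset (Fin n) => ¬ l < T.card)) (fun T : Finset (Fin n) => T.Nonempty),
      Finset.filter_filter, Finset.filter_filter]
    have h2 : (Finset.univ.filter fun T : Finset (Fin n) => ¬ l < T.card ∧ ¬ T.Nonempty) = {∅} := by
      ext T
      simp only [Finset.mem_filter, Finset.mem_univ, true_and, Finset.mem_singleton,
        Finset.not_nonempty_iff_eq_empty]
      constructor
      · exact fun h => h.2
      · rintro rfl; simp
    have h3 : (Finset.univ.filter fun T : Finset (Fin n) => ¬ l < T.card ∧ T.Nonempty) =
        Finset.univ.filter fun T : Finset (Fin n) => T.Nonempty ∧ T.card ≤ l := by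
      ext T; simp [and_comm]
    rw [h2, h3, truncatedProduct, Finset.sum_singleton, Finset.prod_empty]
    ring
  simp_rw [hsplit, Finset.mul_sum]
  have hmg : ∀ (T : Finset (Fin n)) i,
      Integrable (fun x => m i x * (if i ∈ T then g else 1) x) μ := by
    intro T i
    split_ifs
    · exact (hm i).mul_bdd (c := B) hg.aestronglyMeasurable (Filter.Eventually.of_forall hgB)
    · simpa using hm i
  have hprod : ∀ (T : Finset (Fin n)) (X : Fin n → Ω), (∏ i, m i (X i)) * ∏ i ∈ T, g (X i) =
      ∏ i, (m i (X i) * (if i ∈ T then g else 1) (X i)) := by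
    intro T X
    rw [prod_finset_eq_prod_ite, Finset.prod_mul_distrib]
  simp_rw [hprod]
  rw [integral_finsetSum _ fun T _ => Integrable.fintype_prod (hmg T)]
  refine Finset.sum_eq_zero fun T hT => ?_
  rw [integral_fintype_prod_eq_prod
    (f := fun i x => m i x * (if i ∈ T then g else 1) x)]
  -- Since `l < T.card`, the set `T` is not contained in `U`; at such an index only the mean-zero
  -- `g` remains.
  obtain ⟨i, hiT, hiU⟩ : ∃ i ∈ T, i ∉ U := by
    by_contra! hcon
    have := Finset.card_le_card (show T ⊆ U from hcon)
    simp only [Finset.mem_filter, Finset.mem_univ, true_and] at hT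
    omega
  refine Finset.prod_eq_zero (Finset.mem_univ i) ?_
  simp [hmU i hiU, hiT, hg0]

theorem integral_truncatedProduct {g : Ω → ℝ} (hg : Measurable g) {B : ℝ}
    (hgB : ∀ x, |g x| ≤ B) (hg0 : ∫ x, g x ∂μ = 0) (l : ℕ) :
    ∫ X : Fin n → Ω, truncatedProduct n l g X ∂Measure.pi (fun _ => μ) = 0 := by
  unfold truncatedProduct
  rw [integral_finsetSum _ fun T _ => memLp_one_iff_integrable.1 (memLp_prod_of_bound hg hgB T 1)]
  refine Finset.sum_eq_zero fun T hT => ?_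
  have h := integral_prod_mul_prod_finset (μ := μ) hg0 hg0 T ∅
  simp only [Finset.prod_empty, mul_one] at h
  rw [h, if_neg]
  simp only [Finset.mem_filter, Finset.mem_univ, true_and] at hT
  exact hT.1.ne_empty

end TruncatedProduct

/-! ### Products of measures with densities -/

theorem MeasureTheory.Measure.pi_withDensity_ofReal {Ω : Type*} [MeasurableSpace Ω] {n : ℕ}
    {μ : Measure Ω} [IsProbabilityMeasure μ] {f : Ω → ℝ} (hf0 : ∀ x, 0 ≤ f x)
    (hfi : Integrable f μ) :
    Measure.pi (fun _ : Fin n => μ.withDensity fun x => ENNReal.ofReal (f x)) =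
      (Measure.pi fun _ : Fin n => μ).withDensity fun X => ENNReal.ofReal (∏ i, f (X i)) := by
  have : IsFiniteMeasure (μ.withDensity fun x => ENNReal.ofReal (f x)) :=
    isFiniteMeasure_withDensity_ofReal hfi.2
  refine Measure.pi_eq fun s hs => ?_
  have hpi : MeasurableSet (Set.univ.pi s) := MeasurableSet.univ_pi hs
  have h1 : ∀ i, (μ.withDensity fun x => ENNReal.ofReal (f x)) (s i) =
      ENNReal.ofReal (∫ x, (s i).indicator f x ∂μ) := by
    intro i
    rw [withDensity_apply _ (hs i), integral_indicator (hs i), ofReal_integral_eq_lintegral_ofReal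
      hfi.integrableOn (Filter.Eventually.of_forall hf0)]
  have hint : Integrable (fun X : Fin n → Ω => ∏ i, f (X i)) (Measure.pi fun _ => μ) :=
    Integrable.fintype_prod fun _ => hfi
  rw [withDensity_apply _ hpi, ← ofReal_integral_eq_lintegral_ofReal hint.integrableOn
    (Filter.Eventually.of_forall fun X => Finset.prod_nonneg fun i _ => hf0 _),
    ← integral_indicator hpi]
  simp_rw [h1]
  rw [← ENNReal.ofReal_prod_of_nonneg fun i _ =>
    integral_nonneg fun x => Set.indicator_nonneg (fun x _ => hf0 x) x,
    ← integral_fintype_prod_eq_prod (f := fun i x => (s i).indicator f x)]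
  congr 2
  ext X
  by_cases hX : X ∈ Set.univ.pi s
  · rw [Set.indicator_of_mem hX]
    exact Finset.prod_congr rfl fun i _ => (Set.indicator_of_mem (hX i trivial) _).symm
  · rw [Set.indicator_of_notMem hX]
    simp only [Set.mem_univ_pi, not_forall] at hX
    obtain ⟨i, hi⟩ := hX
    exact (Finset.prod_eq_zero (Finset.mem_univ i) (Set.indicator_of_notMem hi _)).symm

/-! ### Low-degree projections of product likelihood ratios -/

theorem inner_toLp_eq_integral {Ω : Type*} [MeasurableSpace Ω] {μ : Measure Ω} {f g : Ω → ℝ}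
    (hf : MemLp f 2 μ) (hg : MemLp g 2 μ) :
    inner ℝ (hf.toLp f) (hg.toLp g) = ∫ x, f x * g x ∂μ := by
  rw [L2.inner_def]
  refine integral_congr_ae ?_
  filter_upwards [hf.coeFn_toLp, hg.coeFn_toLp] with x h1 h2
  rw [h1, h2, RCLike.inner_apply, conj_trivial, mul_comm]

namespace RCNHalfspace

variable {n d : ℕ}

theorem measurable_sampleCoord (j : Option (Fin d)) :
    Measurable fun z : Sample d => sampleCoord z j := by
  cases j with
  | none => exact measurable_snd
  | some j => exact (by fun_prop : Measurable fun z : Sample d => z.1 j)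

theorem measurable_prod_sampleCoord_pow (e : Option (Fin d) → ℕ) :
    Measurable fun z : Sample d => ∏ j, sampleCoord z j ^ e j :=
  Finset.measurable_fun_prod _ fun j _ => (measurable_sampleCoord j).pow_const _

theorem evalSamples_eq_sum (P : MvPolynomial (Fin n × Option (Fin d)) ℝ) (X : Fin n → Sample d) :
    evalSamples P X =
      ∑ m ∈ P.support, P.coeff m * ∏ i, ∏ j, sampleCoord (X i) j ^ m (i, j) := by
  rw [evalSamples, MvPolynomial.eval_eq']
  simp_rw [Fintype.prod_prod_type]

variable {D₀ : Measure (Sample d)} [IsProbabilityMeasure D₀]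

/-- The square of a monomial is again a monomial, so integrability of all monomials in one example
is enough. -/
theorem memLp_evalSamples
    (hmon : ∀ e : Option (Fin d) → ℕ, Integrable (fun z => ∏ j, sampleCoord z j ^ e j) D₀)
    (P : MvPolynomial (Fin n × Option (Fin d)) ℝ) :
    MemLp (evalSamples P) 2 (sampleLaw n D₀) := by
  have h : evalSamples P = fun X : Fin n → Sample d =>
      ∑ m ∈ P.support, P.coeff m * ∏ i, ∏ j, sampleCoord (X i) j ^ m (i, j) :=
    funext fun X => evalSamples_eq_sum P X
  rw [h]
  refine memLp_finsetSum _ fun m _ => MemLp.const_mul ?_ _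
  rw [memLp_two_iff_integrable_sq]
  · have h2 : ∀ X : Fin n → Sample d, (∏ i, ∏ j, sampleCoord (X i) j ^ m (i, j)) ^ 2 =
        ∏ i, ∏ j, sampleCoord (X i) j ^ (m (i, j) * 2) := by
      intro X
      simp_rw [← Finset.prod_pow, ← pow_mul]
    simp_rw [h2]
    exact Integrable.fintype_prod
      (f := fun i z => ∏ j, sampleCoord z j ^ (m (i, j) * 2)) fun i => hmon _
  · exact (Finset.measurable_fun_prod _ fun i _ => (measurable_prod_sampleCoord_pow
      (fun j => m (i, j))).comp (measurable_pi_apply i)).aestronglyMeasurable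

theorem memLp_prod_one_add {g : Sample d → ℝ} {B : ℝ} (hg : Measurable g)
    (hgB : ∀ z, |g z| ≤ B) :
    MemLp (fun X : Fin n → Sample d => ∏ i, (1 + g (X i))) 2 (sampleLaw n D₀) :=
  memLp_prod_of_bound (g := fun z => 1 + g z) (measurable_const.add hg) (B := 1 + B)
    (fun z => (abs_add_le _ _).trans (by rw [abs_one]; linarith [hgB z])) Finset.univ 2

theorem integral_evalSamples_mul_sub_truncatedProduct
    (hmon : ∀ e : Option (Fin d) → ℕ, Integrable (fun z => ∏ j, sampleCoord z j ^ e j) D₀)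
    {g : Sample d → ℝ} (hg : Measurable g) {B : ℝ} (hgB : ∀ z, |g z| ≤ B)
    (hg0 : ∫ z, g z ∂D₀ = 0) {l : ℕ} {P : MvPolynomial (Fin n × Option (Fin d)) ℝ}
    (hP : HasSamplewiseDegree ⊤ l P) :
    ∫ X, evalSamples P X * (∏ i, (1 + g (X i)) - (1 + truncatedProduct n l g X))
      ∂sampleLaw n D₀ = 0 := by
  simp_rw [evalSamples_eq_sum, Finset.sum_mul, mul_assoc]
  have h1 : MemLp (fun X : Fin n → Sample d => ∏ i, (1 + g (X i))) 2 (sampleLaw n D₀) :=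
    memLp_prod_one_add hg hgB
  have h2 : MemLp (fun X : Fin n → Sample d => 1 + truncatedProduct n l g X) 2 (sampleLaw n D₀) :=
    (memLp_const (1 : ℝ)).add (memLp_truncatedProduct hg hgB l 2)
  have hbdd : MemLp (fun X : Fin n → Sample d =>
      ∏ i, (1 + g (X i)) - (1 + truncatedProduct n l g X)) 2 (sampleLaw n D₀) := h1.sub h2
  rw [integral_finsetSum]
  · refine Finset.sum_eq_zero fun m hm => ?_
    classical
    rw [integral_const_mul]
    rw [integral_prod_mul_sub_truncatedProduct hg hgB hg0
      (fun i z => ∏ j, sampleCoord z j ^ m (i, j)) (fun i => hmon _)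
      (Finset.univ.filter fun i => ∃ j, m (i, j) ≠ 0) ?_ ?_, mul_zero]
    · refine le_trans (le_of_eq ?_) (hP m hm).1
      rw [← Set.ncard_coe_finset]
      simp
    · intro i hi
      simp only [Finset.mem_filter, Finset.mem_univ, true_and, not_exists, not_not] at hi
      ext z
      simp [hi]
  · intro m _
    refine Integrable.const_mul ?_ _
    refine MemLp.integrable_mul (p := 2) (q := 2) ?_ hbdd
    have := memLp_evalSamples (n := n) hmon (MvPolynomial.monomial m 1)
    refine this.congr_norm ?_ ?_
    · exact (Finset.measurable_fun_prod _ fun i _ => (measurable_prod_sampleCoord_pow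
        (fun j => m (i, j))).comp (measurable_pi_apply i)).aestronglyMeasurable
    · refine Filter.Eventually.of_forall fun X => ?_
      rw [evalSamples, MvPolynomial.eval_monomial, one_mul,
        Finsupp.prod_fintype _ _ (fun _ => pow_zero _), Fintype.prod_prod_type]

theorem sampleLaw_eq_withDensity {D : Measure (Sample d)} {g : Sample d → ℝ} {B : ℝ} (hg : Measurable g)
    (hgB : ∀ z, |g z| ≤ B) (hg1 : ∀ z, 0 ≤ 1 + g z)
    (hD : D = D₀.withDensity fun z => ENNReal.ofReal (1 + g z)) :
    sampleLaw n D =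
      (sampleLaw n D₀).withDensity fun X => ENNReal.ofReal (∏ i, (1 + g (X i))) := by
  rw [hD]
  refine Measure.pi_withDensity_ofReal hg1 ((integrable_const 1).add ?_)
  exact Integrable.of_bound hg.aestronglyMeasurable B (Filter.Eventually.of_forall hgB)

theorem likelihoodRatio_sampleLaw_ae_eq {D : Measure (Sample d)} {g : Sample d → ℝ} {B : ℝ}
    (hg : Measurable g) (hgB : ∀ z, |g z| ≤ B) (hg1 : ∀ z, 0 ≤ 1 + g z)
    (hD : D = D₀.withDensity fun z => ENNReal.ofReal (1 + g z)) :
    likelihoodRatio (sampleLaw n D) (sampleLaw n D₀) =ᵐ[sampleLaw n D₀]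
      fun X => ∏ i, (1 + g (X i)) := by
  rw [sampleLaw_eq_withDensity hg hgB hg1 hD]
  have hm : Measurable fun X : Fin n → Sample d => ENNReal.ofReal (∏ i, (1 + g (X i))) :=
    (Finset.measurable_fun_prod _ fun i _ =>
      (measurable_const.add hg).comp (measurable_pi_apply i)).ennreal_ofReal
  filter_upwards [Measure.rnDeriv_withDensity (sampleLaw n D₀) hm] with X hX
  rw [likelihoodRatio, hX, ENNReal.toReal_ofReal (Finset.prod_nonneg fun i _ => hg1 _)]

/-- The reduction to pairwise correlations. Polynomials of the allowed degree cannot tell the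
likelihood ratio from `1` plus its truncated product, so both conclusions follow from `‖A‖ ≤ 1`,
where `A` is the average of the truncated products. -/
theorem low_degree_indistinguishable {V : Type*} {S : Finset V} (hS : S.Nonempty)
    {D : V → Measure (Sample d)} {g : V → Sample d → ℝ} {B : ℝ} {l : ℕ}
    (hmon : ∀ e : Option (Fin d) → ℕ, Integrable (fun z => ∏ j, sampleCoord z j ^ e j) D₀)
    (hg : ∀ v, Measurable (g v)) (hgB : ∀ v z, |g v z| ≤ B) (hg1 : ∀ v z, 0 ≤ 1 + g v z)
    (hg0 : ∀ v ∈ S, ∫ z, g v z ∂D₀ = 0)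
    (hD : ∀ v ∈ S, D v = D₀.withDensity fun z => ENNReal.ofReal (1 + g v z))
    (hsum : ∑ u ∈ S, ∑ v ∈ S, truncatedPowerSum n l (∫ z, g u z * g v z ∂D₀) ≤
      (S.card : ℝ) ^ 2) :
    (∀ v ∈ S, sampleLaw n (D v) ≪ sampleLaw n D₀ ∧
      MemLp (likelihoodRatio (sampleLaw n (D v)) (sampleLaw n D₀)) 2 (sampleLaw n D₀)) ∧
    ‖centredLDLR D₀ S D n ⊤ l‖ ^ 2 ≤ 1 ∧
    ∀ P : MvPolynomial (Fin n × Option (Fin d)) ℝ, HasSamplewiseDegree ⊤ l P →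
      |(S.card : ℝ)⁻¹ * ∑ v ∈ S, ∫ X, evalSamples P X ∂(sampleLaw n (D v))
        - ∫ X, evalSamples P X ∂(sampleLaw n D₀)| ≤
      Real.sqrt (variance (evalSamples P) (sampleLaw n D₀)) := by
  set Q := sampleLaw n D₀ with hQ
  have hcard : (0 : ℝ) < S.card := by exact_mod_cast hS.card_pos
  have hΛ : ∀ v, MemLp (fun X : Fin n → Sample d => ∏ i, (1 + g v (X i))) 2 Q :=
    fun v => memLp_prod_one_add (hg v) (hgB v)
  have hT : ∀ v, MemLp (truncatedProduct n l (g v)) 2 Q := fun v =>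
    memLp_truncatedProduct (hg v) (hgB v) l 2
  have hLae : ∀ v ∈ S, likelihoodRatio (sampleLaw n (D v)) Q =ᵐ[Q]
      fun X => ∏ i, (1 + g v (X i)) := fun v hv =>
    likelihoodRatio_sampleLaw_ae_eq (hg v) (hgB v) (hg1 v) (hD v hv)
  have hLmem : ∀ v ∈ S, MemLp (likelihoodRatio (sampleLaw n (D v)) Q) 2 Q := fun v hv =>
    (memLp_congr_ae (hLae v hv)).2 (hΛ v)
  have hL2 : ∀ v ∈ S, likelihoodRatioL2 (sampleLaw n (D v)) Q = (hΛ v).toLp _ := by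
    intro v hv
    rw [likelihoodRatioL2, dif_pos (hLmem v hv)]
    exact (MemLp.toLp_eq_toLp_iff _ _).2 (hLae v hv)
  set W := polySubspace Q ⊤ l with hW
  set one : Lp ℝ 2 Q := Lp.const 2 Q (1 : ℝ) with hone
  have hone' : one = (memLp_const (1 : ℝ)).toLp (fun _ => (1 : ℝ)) := rfl
  have honeW : one ∈ W := by
    refine ⟨1, ?_, ?_⟩
    · intro m hm
      have : m = 0 := by
        by_contra hne
        rw [MvPolynomial.mem_support_iff, MvPolynomial.coeff_one, if_neg (Ne.symm hne)] at hm
        exact hm rfl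
      subst this
      simp
    · filter_upwards [Lp.coeFn_const 2 Q (1 : ℝ)] with X hX
      rw [hone, hX]
      simp [evalSamples]
  have horth : ∀ v ∈ S, ∀ P : MvPolynomial (Fin n × Option (Fin d)) ℝ,
      HasSamplewiseDegree ⊤ l P →
      inner ℝ ((memLp_evalSamples hmon P).toLp (evalSamples P))
        ((hΛ v).toLp _ - (one + (hT v).toLp _)) = 0 := by
    intro v hv P hP
    rw [hone', ← MemLp.toLp_add, ← MemLp.toLp_sub, inner_toLp_eq_integral]
    exact integral_evalSamples_mul_sub_truncatedProduct hmon (hg v) (hgB v) (hg0 v hv) hP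
  set A : Lp ℝ 2 Q := (S.card : ℝ)⁻¹ • ∑ v ∈ S, (hT v).toLp _ with hA
  have hAnorm : ‖A‖ ^ 2 ≤ 1 := by
    rw [← real_inner_self_eq_norm_sq, hA, real_inner_smul_left, real_inner_smul_right, sum_inner]
    simp_rw [inner_sum]
    have : ∑ u ∈ S, ∑ v ∈ S, inner ℝ ((hT u).toLp _) ((hT v).toLp _) =
        ∑ u ∈ S, ∑ v ∈ S, truncatedPowerSum n l (∫ z, g u z * g v z ∂D₀) := by
      refine Finset.sum_congr rfl fun u hu => Finset.sum_congr rfl fun v hv => ?_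
      rw [inner_toLp_eq_integral, integral_truncatedProduct_mul (hg u) (hg v) (hgB u) (hgB v)
        (hg0 u hu) (hg0 v hv)]
    rw [this]
    calc (S.card : ℝ)⁻¹ * ((S.card : ℝ)⁻¹ *
          ∑ u ∈ S, ∑ v ∈ S, truncatedPowerSum n l (∫ z, g u z * g v z ∂D₀))
        ≤ (S.card : ℝ)⁻¹ * ((S.card : ℝ)⁻¹ * (S.card : ℝ) ^ 2) := by gcongr
      _ = 1 := by field_simp
  refine ⟨fun v hv => ⟨?_, hLmem v hv⟩, ?_, ?_⟩
  · rw [sampleLaw_eq_withDensity (hg v) (hgB v) (hg1 v) (hD v hv)]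
    exact withDensity_absolutelyContinuous _ _
  · have hproj : ∀ v ∈ S, lowDegreeProj Q ⊤ l (likelihoodRatioL2 (sampleLaw n (D v)) Q) =
        one + lowDegreeProj Q ⊤ l ((hT v).toLp _) := by
      intro v hv
      have h1 : lowDegreeProj Q ⊤ l one = one :=
        Submodule.starProjection_eq_self_iff.2 (W.le_topologicalClosure honeW)
      have h2 : lowDegreeProj Q ⊤ l ((hΛ v).toLp _ - (one + (hT v).toLp _)) = 0 := by
        rw [lowDegreeProj, Submodule.starProjection_apply_eq_zero_iff,
          Submodule.orthogonal_closure, Submodule.mem_orthogonal]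
        rintro f ⟨P, hP, hf⟩
        have hfP : f = (memLp_evalSamples hmon P).toLp (evalSamples P) :=
          Lp.ext (hf.trans (memLp_evalSamples hmon P).coeFn_toLp.symm)
        rw [hfP]
        exact horth v hv P hP
      rw [hL2 v hv]
      rw [map_sub, map_add, h1, sub_eq_zero] at h2
      exact h2
    -- `A` need not be in the closed polynomial space; contractivity of the projection suffices.
    have hc : centredLDLR D₀ S D n ⊤ l = lowDegreeProj Q ⊤ l A := by
      rw [centredLDLR, Finset.sum_congr rfl hproj, Finset.sum_add_distrib, Finset.sum_const,
        smul_add, ← Nat.cast_smul_eq_nsmul ℝ, smul_smul, inv_mul_cancel₀ hcard.ne', one_smul,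
        add_sub_cancel_left, hA, map_smul, map_sum]
    rw [hc]
    refine le_trans ?_ hAnorm
    gcongr
    exact Submodule.norm_starProjection_apply_le _ _
  · intro P hP
    set p : Lp ℝ 2 Q := (memLp_evalSamples hmon P).toLp (evalSamples P) with hp
    have h1 : ∀ v ∈ S, ∫ X, evalSamples P X ∂(sampleLaw n (D v)) =
        ∫ X, evalSamples P X ∂Q + inner ℝ p ((hT v).toLp _) := by
      intro v hv
      have hm : Measurable fun X : Fin n → Sample d => ENNReal.ofReal (∏ i, (1 + g v (X i))) :=
        (Finset.measurable_fun_prod _ fun i _ =>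
          (measurable_const.add (hg v)).comp (measurable_pi_apply i)).ennreal_ofReal
      have h2 := horth v hv P hP
      rw [inner_sub_right, inner_add_right, sub_eq_zero, hone', inner_toLp_eq_integral,
        inner_toLp_eq_integral] at h2
      simp only [mul_one] at h2
      rw [← h2, sampleLaw_eq_withDensity (hg v) (hgB v) (hg1 v) (hD v hv),
        integral_withDensity_eq_integral_toReal_smul hm
          (Filter.Eventually.of_forall fun _ => ENNReal.ofReal_lt_top)]
      refine integral_congr_ae (Filter.Eventually.of_forall fun X => ?_)
      simp only [smul_eq_mul]
      rw [ENNReal.toReal_ofReal (Finset.prod_nonneg fun i _ => hg1 v _), mul_comm]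
    set a := ∫ X, evalSamples P X ∂Q with ha
    have h3 : (S.card : ℝ)⁻¹ * ∑ v ∈ S, ∫ X, evalSamples P X ∂(sampleLaw n (D v)) - a =
        inner ℝ p A := by
      rw [Finset.sum_congr rfl h1, Finset.sum_add_distrib, Finset.sum_const, nsmul_eq_mul, mul_add,
        ← mul_assoc, inv_mul_cancel₀ hcard.ne', one_mul, add_sub_cancel_left, hA,
        real_inner_smul_right, inner_sum]
    have h4 : inner ℝ one A = 0 := by
      rw [hA, real_inner_smul_right, inner_sum, Finset.sum_eq_zero, mul_zero]
      intro v hv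
      rw [hone', inner_toLp_eq_integral]
      simp only [one_mul]
      exact integral_truncatedProduct (hg v) (hgB v) (hg0 v hv) l
    -- `A` is orthogonal to constants, so the polynomial may be centred and Cauchy–Schwarz yields
    -- its standard deviation.
    have h5 : inner ℝ p A = inner ℝ (p - a • one) A := by
      rw [inner_sub_left, real_inner_smul_left, h4, mul_zero, sub_zero]
    have h6 : ‖p - a • one‖ ^ 2 = variance (evalSamples P) Q := by
      rw [variance_eq_integral (memLp_evalSamples hmon P).aemeasurable, hp, hone',
        ← MemLp.toLp_const_smul, ← MemLp.toLp_sub, ← real_inner_self_eq_norm_sq,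
        inner_toLp_eq_integral]
      refine integral_congr_ae (Filter.Eventually.of_forall fun X => ?_)
      simp [sq, ha, hQ]
    rw [h3, h5, ← h6, Real.sqrt_sq (norm_nonneg _)]
    refine (abs_real_inner_le_norm _ _).trans ?_
    have : ‖A‖ ≤ 1 := by nlinarith [norm_nonneg A]
    exact mul_le_of_le_one_right (norm_nonneg _) this

end RCNHalfspace

/-! ### The noisy halfspace laws -/

theorem MeasureTheory.Measure.map_withDensity_comp {α β : Type*} [MeasurableSpace α]
    [MeasurableSpace β] (μ : Measure α) {f : α → β} (hf : Measurable f) {L : β → ℝ≥0∞}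
    (hL : Measurable L) :
    (μ.withDensity fun x => L (f x)).map f = (μ.map f).withDensity L := by
  ext s hs
  rw [Measure.map_apply hf hs, withDensity_apply _ (hf hs), withDensity_apply _ hs,
    setLIntegral_map hs hL hf]

namespace RCNHalfspace

variable {d : ℕ}

theorem measurable_prodMk_label (y : ℝ) :
    Measurable fun x : EuclideanSpace ℝ (Fin d) => ((x, y) : Sample d) := by fun_prop

theorem isProbabilityMeasure_labelMixture {ρ : ℝ} (h0 : 0 ≤ ρ) (h1 : ρ ≤ 1)
    (A B : Measure (EuclideanSpace ℝ (Fin d))) [IsProbabilityMeasure A] [IsProbabilityMeasure B] :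
    IsProbabilityMeasure (labelMixture ρ A B) := by
  constructor
  simp only [labelMixture, Measure.add_apply, Measure.smul_apply, smul_eq_mul]
  rw [Measure.map_apply (measurable_prodMk_label _) MeasurableSet.univ,
    Measure.map_apply (measurable_prodMk_label _) MeasurableSet.univ]
  simp only [Set.preimage_univ, measure_univ, mul_one]
  rw [← ENNReal.ofReal_add h0 (by linarith)]
  simp

theorem integrable_labelMixture {ρ : ℝ} {A B : Measure (EuclideanSpace ℝ (Fin d))}
    {f : Sample d → ℝ} (hf : Measurable f) (hA : Integrable (fun x => f (x, 1)) A)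
    (hB : Integrable (fun x => f (x, -1)) B) : Integrable f (labelMixture ρ A B) := by
  refine Integrable.add_measure (Integrable.smul_measure ?_ ENNReal.ofReal_ne_top)
    (Integrable.smul_measure ?_ ENNReal.ofReal_ne_top)
  · exact (integrable_map_measure hf.aestronglyMeasurable
      (measurable_prodMk_label 1).aemeasurable).2 hA
  · exact (integrable_map_measure hf.aestronglyMeasurable
      (measurable_prodMk_label (-1)).aemeasurable).2 hB

theorem integral_labelMixture {ρ : ℝ} (h0 : 0 ≤ ρ) (h1 : ρ ≤ 1)
    {A B : Measure (EuclideanSpace ℝ (Fin d))}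
    {f : Sample d → ℝ} (hf : Measurable f) (hA : Integrable (fun x => f (x, 1)) A)
    (hB : Integrable (fun x => f (x, -1)) B) :
    ∫ z, f z ∂labelMixture ρ A B = ρ * ∫ x, f (x, 1) ∂A + (1 - ρ) * ∫ x, f (x, -1) ∂B := by
  have hA' : Integrable f (A.map fun x => (x, (1 : ℝ))) :=
    (integrable_map_measure hf.aestronglyMeasurable
      (measurable_prodMk_label 1).aemeasurable).2 hA
  have hB' : Integrable f (B.map fun x => (x, (-1 : ℝ))) :=
    (integrable_map_measure hf.aestronglyMeasurable
      (measurable_prodMk_label (-1)).aemeasurable).2 hB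
  rw [labelMixture, integral_add_measure (hA'.smul_measure ENNReal.ofReal_ne_top)
    (hB'.smul_measure ENNReal.ofReal_ne_top), integral_smul_measure, integral_smul_measure,
    integral_map (measurable_prodMk_label 1).aemeasurable hf.aestronglyMeasurable,
    integral_map (measurable_prodMk_label (-1)).aemeasurable hf.aestronglyMeasurable,
    ENNReal.toReal_ofReal h0, ENNReal.toReal_ofReal (by linarith), smul_eq_mul, smul_eq_mul]

theorem labelMixture_withDensity (ρ : ℝ) (A B : Measure (EuclideanSpace ℝ (Fin d)))
    {L : Sample d → ℝ≥0∞} (hL : Measurable L) :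
    labelMixture ρ (A.withDensity fun x => L (x, 1)) (B.withDensity fun x => L (x, -1)) =
      (labelMixture ρ A B).withDensity L := by
  rw [labelMixture, labelMixture, withDensity_add_measure, withDensity_smul_measure,
    withDensity_smul_measure, Measure.map_withDensity_comp A (measurable_prodMk_label 1) hL,
    Measure.map_withDensity_comp B (measurable_prodMk_label (-1)) hL]

/-- For a fixed label a monomial is dominated by a constant times a power of `‖x‖`, and Gaussian
measures have all moments. -/
theorem integrable_prod_sampleCoord_pow_nullLaw (ρ : ℝ) (e : Option (Fin d) → ℕ) :
    Integrable (fun z : Sample d => ∏ j, sampleCoord z j ^ e j) (nullLaw d ρ) := by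
  have key : ∀ y : ℝ, Integrable (fun x : EuclideanSpace ℝ (Fin d) =>
      ∏ j, sampleCoord ((x, y) : Sample d) j ^ e j)
      (stdGaussian (EuclideanSpace ℝ (Fin d))) := by
    intro y
    simp_rw [Fintype.prod_option]
    simp only [sampleCoord]
    refine Integrable.const_mul ?_ _
    have hnorm : Integrable (fun x : EuclideanSpace ℝ (Fin d) => ‖x‖ ^ (∑ j, e (some j)))
        (stdGaussian (EuclideanSpace ℝ (Fin d))) :=
      (IsGaussian.memLp_id _ _ (by simp)).integrable_norm_pow' (f := id)
    refine hnorm.mono' ?_ (Filter.Eventually.of_forall fun x => ?_)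
    · exact (Finset.measurable_fun_prod _ fun j _ => by fun_prop).aestronglyMeasurable
    · rw [Real.norm_eq_abs, Finset.abs_prod, ← Finset.prod_pow_eq_pow_sum]
      refine Finset.prod_le_prod (fun _ _ => abs_nonneg _) fun j _ => ?_
      rw [abs_pow]
      gcongr
      exact PiLp.norm_apply_le x j
  exact integrable_labelMixture (measurable_prod_sampleCoord_pow e) (key 1) (key (-1))

/-! ### The score of one labelled example. -/

/-- The coefficient of the centred halfspace in the likelihood ratio given `y = 1`. -/
noncomputable def posCoeff (η t : ℝ) : ℝ := (1 - 2 * η) / (η + (1 - 2 * η) * gaussianTail t)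

/-- Minus the coefficient of the centred halfspace in the likelihood ratio given `y = -1`. -/
noncomputable def negCoeff (η t : ℝ) : ℝ := (1 - 2 * η) / (1 - η - (1 - 2 * η) * gaussianTail t)

open Classical in
/-- The likelihood ratio of `hardLaw` with respect to `nullLaw`, minus `1`. -/
noncomputable def score (η t : ℝ) (v : EuclideanSpace ℝ (Fin d)) (z : Sample d) : ℝ :=
  (if z.2 = 1 then posCoeff η t else -negCoeff η t) * (halfspaceInd t v z.1 - gaussianTail t)

theorem score_pos_label (η t : ℝ) (v x : EuclideanSpace ℝ (Fin d)) :
    score η t v (x, 1) = posCoeff η t * (halfspaceInd t v x - gaussianTail t) := by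
  simp [score]

theorem score_neg_label (η t : ℝ) (v x : EuclideanSpace ℝ (Fin d)) :
    score η t v (x, -1) = -negCoeff η t * (halfspaceInd t v x - gaussianTail t) := by
  rw [score, if_neg (by norm_num)]

theorem measurable_score (η t : ℝ) (v : EuclideanSpace ℝ (Fin d)) : Measurable (score η t v) := by
  refine Measurable.mul ?_ (((measurable_halfspaceInd t v).comp measurable_fst).sub_const _)
  exact Measurable.ite (measurable_snd (measurableSet_singleton 1)) measurable_const
    measurable_const

variable {η : ℝ} (hη0 : 0 < η) (hη : η < 1 / 2)

-- Both denominators are convex combinations of `η` and `1 - η`, with weights given by the Gaussian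
-- tail, hence at least `η`.
include hη in
theorem posDenom_ge (t : ℝ) : η ≤ η + (1 - 2 * η) * gaussianTail t := by
  have := mul_nonneg (by linarith : 0 ≤ 1 - 2 * η) (gaussianTail_nonneg t)
  linarith

include hη in
theorem negDenom_ge (t : ℝ) : η ≤ 1 - η - (1 - 2 * η) * gaussianTail t := by
  have := mul_le_mul_of_nonneg_left (gaussianTail_le_one t) (by linarith : 0 ≤ 1 - 2 * η)
  linarith

include hη0 hη in
theorem posCoeff_mem (t : ℝ) : 0 ≤ posCoeff η t ∧ posCoeff η t ≤ 1 / η := by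
  have h := posDenom_ge hη t
  refine ⟨div_nonneg (by linarith) (by linarith), ?_⟩
  unfold posCoeff
  gcongr
  linarith

include hη0 hη in
theorem negCoeff_mem (t : ℝ) : 0 ≤ negCoeff η t ∧ negCoeff η t ≤ 1 / η := by
  have h := negDenom_ge hη t
  refine ⟨div_nonneg (by linarith) (by linarith), ?_⟩
  unfold negCoeff
  gcongr
  linarith

theorem abs_halfspaceInd_sub_le (t : ℝ) (v x : EuclideanSpace ℝ (Fin d)) :
    |halfspaceInd t v x - gaussianTail t| ≤ 1 := by
  have h1 := halfspaceInd_nonneg t v x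
  have h2 := halfspaceInd_le_one t v x
  have h3 := gaussianTail_nonneg t
  have h4 := gaussianTail_le_one t
  rw [abs_le]; constructor <;> linarith

include hη0 hη in
theorem abs_score_le (t : ℝ) (v : EuclideanSpace ℝ (Fin d)) (z : Sample d) :
    |score η t v z| ≤ 1 / η := by
  have hc : |if z.2 = 1 then posCoeff η t else -negCoeff η t| ≤ 1 / η := by
    split_ifs
    · rw [abs_of_nonneg (posCoeff_mem hη0 hη t).1]; exact (posCoeff_mem hη0 hη t).2
    · rw [abs_neg, abs_of_nonneg (negCoeff_mem hη0 hη t).1]; exact (negCoeff_mem hη0 hη t).2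
  rw [score, abs_mul]
  exact (mul_le_of_le_one_right (abs_nonneg _) (abs_halfspaceInd_sub_le t v z.1)).trans hc

include hη0 hη in
theorem one_add_score_pos_label (t : ℝ) (v x : EuclideanSpace ℝ (Fin d)) :
    1 + score η t v (x, 1) = (η + (1 - 2 * η) * halfspaceInd t v x) /
      (η + (1 - 2 * η) * gaussianTail t) := by
  have h := posDenom_ge hη t
  have h0 : η + (1 - 2 * η) * gaussianTail t ≠ 0 := by linarith
  rw [score_pos_label, posCoeff, eq_div_iff h0]
  linear_combination ((1 - 2 * η) * (halfspaceInd t v x - gaussianTail t)) * (mul_inv_cancel₀ h0)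

include hη0 hη in
theorem one_add_score_neg_label (t : ℝ) (v x : EuclideanSpace ℝ (Fin d)) :
    1 + score η t v (x, -1) = (1 - η - (1 - 2 * η) * halfspaceInd t v x) /
      (1 - η - (1 - 2 * η) * gaussianTail t) := by
  have h := negDenom_ge hη t
  have h0 : 1 - η - (1 - 2 * η) * gaussianTail t ≠ 0 := by linarith
  rw [score_neg_label, negCoeff, eq_div_iff h0]
  linear_combination (-(1 - 2 * η) * (halfspaceInd t v x - gaussianTail t)) * (mul_inv_cancel₀ h0)

-- Every label other than `1` is treated as `-1` by `score`, so nonnegativity holds everywhere and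
-- not only on the support of the laws.
include hη0 hη in
theorem one_add_score_nonneg (t : ℝ) (v : EuclideanSpace ℝ (Fin d)) (z : Sample d) :
    0 ≤ 1 + score η t v z := by
  have h1 := halfspaceInd_nonneg t v z.1
  have h2 := halfspaceInd_le_one t v z.1
  by_cases hz : z.2 = 1
  · have : score η t v z = score η t v (z.1, 1) := by simp [score, hz]
    rw [this, one_add_score_pos_label hη0 hη]
    refine div_nonneg ?_ (by linarith [posDenom_ge hη t])
    nlinarith
  · have : score η t v z = score η t v (z.1, -1) := by
      rw [score_neg_label, score, if_neg hz]
    rw [this, one_add_score_neg_label hη0 hη]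
    refine div_nonneg ?_ (by linarith [negDenom_ge hη t])
    nlinarith

include hη0 hη in
theorem hardLaw_eq_withDensity (ρ t : ℝ) (v : EuclideanSpace ℝ (Fin d)) :
    hardLaw ρ η t v = (nullLaw d ρ).withDensity fun z => ENNReal.ofReal (1 + score η t v z) := by
  have hm : Measurable fun z : Sample d => ENNReal.ofReal (1 + score η t v z) :=
    (measurable_const.add (measurable_score η t v)).ennreal_ofReal
  rw [hardLaw, nullLaw, ← labelMixture_withDensity _ _ _ hm, lawPos, lawNeg]
  simp_rw [one_add_score_pos_label hη0 hη, one_add_score_neg_label hη0 hη]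

theorem integrable_halfspaceInd_sub (t : ℝ) (v : EuclideanSpace ℝ (Fin d)) :
    Integrable (fun x => halfspaceInd t v x - gaussianTail t)
      (stdGaussian (EuclideanSpace ℝ (Fin d))) :=
  (integrable_halfspaceInd t v).sub (integrable_const _)

theorem integral_score {ρ : ℝ} (h0 : 0 ≤ ρ) (h1 : ρ ≤ 1) (η t : ℝ)
    {v : EuclideanSpace ℝ (Fin d)} (hv : ‖v‖ = 1) :
    ∫ z, score η t v z ∂nullLaw d ρ = 0 := by
  have h : ∫ x, (halfspaceInd t v x - gaussianTail t)
      ∂stdGaussian (EuclideanSpace ℝ (Fin d)) = 0 := by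
    rw [integral_sub (integrable_halfspaceInd t v) (integrable_const _),
      integral_halfspaceInd t hv]
    simp
  have hi := integrable_halfspaceInd_sub t v
  rw [nullLaw, integral_labelMixture h0 h1 (measurable_score η t v)]
  · simp_rw [score_pos_label, score_neg_label]
    rw [integral_const_mul, integral_const_mul, h]; simp
  · simp_rw [score_pos_label]; exact hi.const_mul _
  · simp_rw [score_neg_label]; exact hi.const_mul _

/-- On each label both scores carry the same coefficient, so its sign squares away and the label
marginal only averages the two squares. -/
theorem integral_score_mul {ρ : ℝ} (h0 : 0 ≤ ρ) (h1 : ρ ≤ 1) (η t : ℝ)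
    {u v : EuclideanSpace ℝ (Fin d)} (hu : ‖u‖ = 1) (hv : ‖v‖ = 1) :
    ∫ z, score η t u z * score η t v z ∂nullLaw d ρ =
      (ρ * posCoeff η t ^ 2 + (1 - ρ) * negCoeff η t ^ 2) *
        (∫ x, halfspaceInd t u x * halfspaceInd t v x
          ∂stdGaussian (EuclideanSpace ℝ (Fin d)) - gaussianTail t ^ 2) := by
  set p := gaussianTail t with hp
  have huv := integrable_halfspaceInd_mul t u v
  have hexp : ∀ x, (halfspaceInd t u x - p) * (halfspaceInd t v x - p) =
      halfspaceInd t u x * halfspaceInd t v x - p * halfspaceInd t u x -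
        p * halfspaceInd t v x + p ^ 2 := fun x => by ring
  have hi1 := (integrable_halfspaceInd t u).const_mul p
  have hi2 := (integrable_halfspaceInd t v).const_mul p
  have h : ∫ x, (halfspaceInd t u x - p) * (halfspaceInd t v x - p)
      ∂stdGaussian (EuclideanSpace ℝ (Fin d)) = ∫ x, halfspaceInd t u x * halfspaceInd t v x
          ∂stdGaussian (EuclideanSpace ℝ (Fin d)) - p ^ 2 := by
    simp_rw [hexp]
    rw [integral_add (by exact (huv.sub hi1).sub hi2) (integrable_const _),
      integral_sub (by exact huv.sub hi1) hi2,
      integral_sub huv hi1, integral_const_mul, integral_const_mul, integral_halfspaceInd t hu,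
      integral_halfspaceInd t hv]
    simp only [integral_const, probReal_univ, smul_eq_mul, ← hp]
    ring
  have hi : Integrable (fun x => (halfspaceInd t u x - p) * (halfspaceInd t v x - p))
      (stdGaussian (EuclideanSpace ℝ (Fin d))) := by
    simp_rw [hexp]
    exact ((huv.sub hi1).sub hi2).add (integrable_const _)
  have hpos : ∀ x, score η t u (x, 1) * score η t v (x, 1) =
      posCoeff η t ^ 2 * ((halfspaceInd t u x - p) * (halfspaceInd t v x - p)) := fun x => by
    rw [score_pos_label, score_pos_label]; ring
  have hneg : ∀ x, score η t u (x, -1) * score η t v (x, -1) =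
      negCoeff η t ^ 2 * ((halfspaceInd t u x - p) * (halfspaceInd t v x - p)) := fun x => by
    rw [score_neg_label, score_neg_label]; ring
  rw [nullLaw, integral_labelMixture h0 h1
    (by exact (measurable_score η t u).mul (measurable_score η t v))]
  · simp_rw [hpos, hneg]
    rw [integral_const_mul, integral_const_mul, h]; ring
  · simp_rw [hpos]; exact hi.const_mul _
  · simp_rw [hneg]; exact hi.const_mul _

include hη0 hη in
theorem abs_integral_score_mul_le {ρ : ℝ} (h0 : 0 ≤ ρ) (h1 : ρ ≤ 1) (t : ℝ)
    {u v : EuclideanSpace ℝ (Fin d)} (hu : ‖u‖ = 1) (hv : ‖v‖ = 1) :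
    |∫ z, score η t u z * score η t v z ∂nullLaw d ρ| ≤
      1 / η ^ 2 * |∫ x, halfspaceInd t u x * halfspaceInd t v x
          ∂stdGaussian (EuclideanSpace ℝ (Fin d)) - gaussianTail t ^ 2| := by
  rw [integral_score_mul h0 h1 η t hu hv, abs_mul]
  gcongr
  have hA := posCoeff_mem hη0 hη t
  have hB := negCoeff_mem hη0 hη t
  have hA2 : posCoeff η t ^ 2 ≤ 1 / η ^ 2 := by
    rw [← one_div_pow]; exact pow_le_pow_left₀ hA.1 hA.2 2
  have hB2 : negCoeff η t ^ 2 ≤ 1 / η ^ 2 := by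
    rw [← one_div_pow]; exact pow_le_pow_left₀ hB.1 hB.2 2
  rw [abs_of_nonneg (add_nonneg (by positivity) (mul_nonneg (by linarith) (sq_nonneg _)))]
  nlinarith

end RCNHalfspace

/-! ### Choice of parameters -/

theorem Real.exp_mul_sub_one_le {ε x : ℝ} (h0 : 0 ≤ ε) (h1 : ε ≤ 1) :
    Real.exp (ε * x) - 1 ≤ ε * (Real.exp x - 1) := by
  have h := convexOn_exp.2 (Set.mem_univ x) (Set.mem_univ 0) h0 (by linarith : 0 ≤ 1 - ε) (by ring)
  simp only [smul_eq_mul, mul_zero, add_zero, Real.exp_zero, mul_one] at h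
  linarith

/-- Convexity of `exp` turns a small factor in the exponent into a small factor in front, leaving
exactly the `cosh` controlled by the choice of `S`. -/
theorem abs_truncatedPowerSum_le_cosh {n : ℕ} (l : ℕ) {z ε y : ℝ} (h0 : 0 ≤ ε) (h1 : ε ≤ 1)
    (hz : n * |z| ≤ ε * |y|) : |truncatedPowerSum n l z| ≤ 2 * ε * Real.cosh y := by
  have h2 : Real.exp |y| ≤ 2 * Real.cosh y := by
    rw [← Real.cosh_abs, Real.cosh_eq]
    linarith [Real.exp_pos (-|y|)]
  calc |truncatedPowerSum n l z| ≤ Real.exp (n * |z|) - 1 := abs_truncatedPowerSum_le n l z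
    _ ≤ Real.exp (ε * |y|) - 1 := by gcongr
    _ ≤ ε * (Real.exp |y| - 1) := Real.exp_mul_sub_one_le h0 h1
    _ ≤ ε * (2 * Real.cosh y) := by gcongr; linarith
    _ = _ := by ring

theorem exists_forall_le_rpow {c : ℝ} (hc0 : 0 < c) (hc : c < 1 / 2) (R R' : ℝ) :
    ∃ d₀ : ℕ, ∀ d : ℕ, d₀ ≤ d → 0 < d ∧ R ≤ (d : ℝ) ^ (c / 4) ∧
      (d : ℝ) ^ (-(1 / 2 : ℝ) + c) ≤ 1 / 4 ∧
      (1 / 4 < c → R' ≤ (d : ℝ) ^ (2 * c - 1 / 2)) := by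
  have hcast := tendsto_natCast_atTop_atTop (R := ℝ)
  have h1 := ((tendsto_rpow_atTop (by positivity : 0 < c / 4)).comp hcast).eventually_ge_atTop R
  have h2 := ((tendsto_rpow_neg_atTop (by linarith : 0 < 1 / 2 - c)).comp hcast).eventually_le_const
    (by norm_num : (0 : ℝ) < 1 / 4)
  have h3 : ∀ᶠ d : ℕ in Filter.atTop, 1 / 4 < c → R' ≤ (d : ℝ) ^ (2 * c - 1 / 2) := by
    by_cases h : 1 / 4 < c
    · filter_upwards [((tendsto_rpow_atTop (by linarith : 0 < 2 * c - 1 / 2)).comp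
        hcast).eventually_ge_atTop R'] with d hd _ using hd
    · exact Filter.Eventually.of_forall fun d h' => absurd h' h
  obtain ⟨d₀, h⟩ := Filter.eventually_atTop.1
    ((Filter.eventually_gt_atTop 0).and (h1.and (h2.and h3)))
  refine ⟨d₀, fun d hd => ?_⟩
  obtain ⟨ha, hb, hc, he⟩ := h d hd
  refine ⟨ha, hb, ?_, he⟩
  simp only [Function.comp] at hc
  rwa [show -(1 / 2 - c) = -(1 / 2) + c by ring] at hc

/-- A tail that is not too small forces a moderate threshold, by the Chernoff bound `p ≤ exp
(-t²/2)`. -/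
theorem sq_le_of_le_gaussianTail {C y t : ℝ} (ht : 0 ≤ t) (hy : 0 ≤ C * y)
    (h : (2 : ℝ) ^ (-(C * y)) ≤ RCNHalfspace.gaussianTail t) : t ^ 2 ≤ 2 * C * y := by
  have h1 := h.trans (gaussianTail_le_exp ht)
  rw [Real.rpow_def_of_pos two_pos, Real.exp_le_exp] at h1
  have := Real.log_two_lt_d9
  nlinarith

/-- Here `δ = x⁴` must work for all `c` at once. If `c ≤ 1/4`, then `δ^(1/2-c) ≤ x` absorbs the
constants, and `t² = O(d^c)` comes from the tail bound. If `c > 1/4`, the power of `δ` may be close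
to `1`; instead `t² ≤ d^(1/2-c)/4` leaves the spare factor `d^(2c-1/2)`, large for large `d`. -/
theorem rpow_mul_one_add_sq_le {A C c x t : ℝ} (hA : 0 < A) (hc0 : 0 < c)
    (hc : c < 1 / 2) (hx0 : 0 < x) (hx1 : x ≤ 1) (hx : x * (A * (2 + 4 * C)) ≤ 1 / 12) {d : ℕ}
    (hd : 0 < d) (hlarge : 1 / 4 < c → 36 * A ≤ (d : ℝ) ^ (2 * c - 1 / 2))
    (ht1 : t ^ 2 ≤ 2 * C * (d : ℝ) ^ c) (ht2 : t ^ 2 ≤ (d : ℝ) ^ (1 / 2 - c) / 4) :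
    (x ^ 4 * (d : ℝ)) ^ (1 / 2 - c) * (A * (1 + t) ^ 2) ≤ 1 / 12 * Real.sqrt d := by
  have hd1 : (1 : ℝ) ≤ d := by exact_mod_cast hd
  have hd0 : (0 : ℝ) < d := by linarith
  have hyc : 1 ≤ (d : ℝ) ^ c := Real.one_le_rpow hd1 hc0.le
  have hsq : (1 + t) ^ 2 ≤ 2 + 2 * t ^ 2 := by nlinarith [sq_nonneg (1 - t)]
  have key : (x ^ 4) ^ (1 / 2 - c) * (A * (1 + t) ^ 2) ≤ 1 / 12 * (d : ℝ) ^ c := by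
    have hx4 : x ^ 4 ≤ 1 := pow_le_one₀ hx0.le hx1
    rcases le_or_gt c (1 / 4) with h | h
    · have h1 : (x ^ 4) ^ (1 / 2 - c) ≤ x := by
        calc (x ^ 4) ^ (1 / 2 - c) ≤ (x ^ 4) ^ (1 / 4 : ℝ) :=
              Real.rpow_le_rpow_of_exponent_ge (by positivity) hx4 (by linarith)
          _ = x := by
              rw [← Real.rpow_natCast, ← Real.rpow_mul hx0.le]; norm_num
      calc (x ^ 4) ^ (1 / 2 - c) * (A * (1 + t) ^ 2) ≤ x * (A * (2 + 2 * t ^ 2)) := by gcongr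
        _ ≤ x * (A * ((2 + 4 * C) * (d : ℝ) ^ c)) := by gcongr; nlinarith
        _ = x * (A * (2 + 4 * C)) * (d : ℝ) ^ c := by ring
        _ ≤ _ := by gcongr
    · have h1 : (x ^ 4) ^ (1 / 2 - c) ≤ 1 := Real.rpow_le_one (by positivity) hx4 (by linarith)
      have h2 : 1 ≤ (d : ℝ) ^ (1 / 2 - c) := Real.one_le_rpow hd1 (by linarith)
      calc (x ^ 4) ^ (1 / 2 - c) * (A * (1 + t) ^ 2) ≤ 1 * (A * (2 + 2 * t ^ 2)) := by gcongr
        _ ≤ 1 / 12 * (36 * A * (d : ℝ) ^ (1 / 2 - c)) := by nlinarith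
        _ ≤ 1 / 12 * ((d : ℝ) ^ (2 * c - 1 / 2) * (d : ℝ) ^ (1 / 2 - c)) := by
            gcongr; exact hlarge h
        _ = _ := by rw [← Real.rpow_add hd0]; ring_nf
  calc (x ^ 4 * (d : ℝ)) ^ (1 / 2 - c) * (A * (1 + t) ^ 2)
      = (x ^ 4) ^ (1 / 2 - c) * (A * (1 + t) ^ 2) * (d : ℝ) ^ (1 / 2 - c) := by
        rw [Real.mul_rpow (by positivity) hd0.le]; ring
    _ ≤ 1 / 12 * (d : ℝ) ^ c * (d : ℝ) ^ (1 / 2 - c) := by gcongr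
    _ = _ := by
        rw [mul_assoc, ← Real.rpow_add hd0, Real.sqrt_eq_rpow]; ring_nf

/-- A cardinality between `exp (y ^ 2 / 4)` and a fixed fraction of `exp (y ^ 2 / 2)`. -/
theorem exists_card {y : ℝ} (hy : 6 ≤ y) :
    ∃ N : ℕ, 3 * (N : ℝ) < Real.exp (y ^ 2 / 2) / 2 ∧ Real.exp (y ^ 2 / 4) ≤ N := by
  set E := Real.exp (y ^ 2 / 4) with hE
  have hE2 : Real.exp (y ^ 2 / 2) = E ^ 2 := by
    rw [hE, ← Real.exp_nat_mul]; congr 1; push_cast; ring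
  have hE8 : 8 ≤ E := by
    have := Real.add_one_le_exp (y ^ 2 / 4)
    nlinarith
  -- Any constant above `6` meets the upper bound; with `7`, `E ≥ 8` gives `E²/7 - 1 ≥ E`.
  refine ⟨⌊E ^ 2 / 7⌋₊, ?_, ?_⟩
  · have := Nat.floor_le (by positivity : 0 ≤ E ^ 2 / 7)
    rw [hE2]; nlinarith
  · have := Nat.lt_floor_add_one (E ^ 2 / 7)
    nlinarith

/-- With `w = d^(c/4)`, both `d` and `1/p²` are `exp (O(w⁴))` and `l ≤ w`, so the left side is `exp
(O(w⁵))`, against `exp (w⁸/4)` on the right. -/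
theorem two_mul_pow_mul_exp_le {C K c p : ℝ} (hC : 0 < C) (hK : 0 ≤ K) (hc0 : 0 < c)
    {d n l : ℕ} (hd : 0 < d)
    (hw1 : 4 * (K + 2 * C + 2) ≤ (d : ℝ) ^ (c / 4)) (hw2 : 1 + 2 / c ≤ (d : ℝ) ^ (c / 4))
    (hp0 : (2 : ℝ) ^ (-(C * (d : ℝ) ^ c)) ≤ p)
    (hn : (n : ℝ) ≤ (d : ℝ) ^ (1 / 2 - c) / p ^ 2) (hl : (l : ℝ) ≤ (d : ℝ) ^ (c / 4)) :
    2 * (((n : ℝ) + 1) ^ l * Real.exp K) ≤ Real.exp (((d : ℝ) ^ c) ^ 2 / 4) := by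
  have hd1 : (1 : ℝ) ≤ d := by exact_mod_cast hd
  set w := (d : ℝ) ^ (c / 4) with hw
  have hwc : (d : ℝ) ^ c = w ^ 4 := by
    rw [hw, ← Real.rpow_natCast, ← Real.rpow_mul (by linarith)]; congr 1; push_cast; ring
  have hwc2 : (d : ℝ) ^ (c / 2) = w ^ 2 := by
    rw [hw, ← Real.rpow_natCast, ← Real.rpow_mul (by linarith)]; congr 1; push_cast; ring
  rw [hwc] at hp0 ⊢
  have hw1' : 1 ≤ w := by linarith
  have hw0 : 0 ≤ w := by linarith
  have hpexp : Real.exp (-(C * w ^ 4)) ≤ p := by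
    refine le_trans ?_ hp0
    rw [Real.rpow_def_of_pos two_pos, Real.exp_le_exp]
    have := Real.log_two_lt_d9
    have : 0 ≤ C * w ^ 4 := by positivity
    nlinarith
  have hlog : 2 * (d : ℝ) ≤ Real.exp (w ^ 4) := by
    rw [← Real.log_le_iff_le_exp (by positivity), Real.log_mul two_ne_zero (by positivity)]
    have h1 := Real.log_le_rpow_div (by linarith : (0 : ℝ) ≤ d) (by positivity : 0 < c / 2)
    rw [hwc2, div_div_eq_mul_div] at h1
    have h2 := Real.log_two_lt_d9
    have h3 : w ^ 2 * 2 / c = 2 / c * w ^ 2 := by ring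
    have h4 : (1 + 2 / c) * w ^ 2 ≤ w * w ^ 2 := by gcongr
    have h5 : w * w ^ 2 ≤ w ^ 4 := by
      calc w * w ^ 2 = w ^ 3 := by ring
        _ ≤ w ^ 4 := pow_le_pow_right₀ hw1' (by norm_num)
    nlinarith [one_le_pow₀ hw1' (n := 2)]
  have hpinv : 1 / p ^ 2 ≤ Real.exp (2 * (C * w ^ 4)) := by
    rw [one_div, show 2 * (C * w ^ 4) = -(2 * -(C * w ^ 4)) by ring, Real.exp_neg]
    gcongr
    calc Real.exp (2 * -(C * w ^ 4)) = Real.exp (-(C * w ^ 4)) ^ 2 := by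
          rw [← Real.exp_nat_mul]; norm_num
      _ ≤ p ^ 2 := by gcongr
  have hp : 0 < p := (Real.exp_pos _).trans_le hpexp
  have hn1 : (n : ℝ) + 1 ≤ Real.exp ((2 * C + 1) * w ^ 4) := by
    have h1 : (d : ℝ) ^ (1 / 2 - c) ≤ d := by
      calc (d : ℝ) ^ (1 / 2 - c) ≤ (d : ℝ) ^ (1 : ℝ) :=
            Real.rpow_le_rpow_of_exponent_le hd1 (by linarith)
        _ = d := Real.rpow_one _
    have h2 : 1 ≤ Real.exp (2 * (C * w ^ 4)) := Real.one_le_exp (by positivity)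
    calc (n : ℝ) + 1 ≤ d * (1 / p ^ 2) + 1 := by
          rw [mul_one_div]
          have : (d : ℝ) ^ (1 / 2 - c) / p ^ 2 ≤ d / p ^ 2 := by gcongr
          linarith
      _ ≤ d * Real.exp (2 * (C * w ^ 4)) + d * Real.exp (2 * (C * w ^ 4)) := by
          gcongr
          nlinarith
      _ = 2 * d * Real.exp (2 * (C * w ^ 4)) := by ring
      _ ≤ Real.exp (w ^ 4) * Real.exp (2 * (C * w ^ 4)) := by gcongr
      _ = _ := by rw [← Real.exp_add]; ring_nf
  have hpow : ((n : ℝ) + 1) ^ l ≤ Real.exp ((2 * C + 1) * w ^ 5) := by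
    calc ((n : ℝ) + 1) ^ l ≤ Real.exp ((2 * C + 1) * w ^ 4) ^ l := by gcongr
      _ = Real.exp (l * ((2 * C + 1) * w ^ 4)) := (Real.exp_nat_mul _ _).symm
      _ ≤ Real.exp (w * ((2 * C + 1) * w ^ 4)) := by gcongr
      _ = _ := by ring_nf
  calc 2 * (((n : ℝ) + 1) ^ l * Real.exp K)
      ≤ Real.exp 1 * (Real.exp ((2 * C + 1) * w ^ 5) * Real.exp K) := by
        gcongr
        linarith [Real.exp_one_gt_d9]
    _ = Real.exp (1 + ((2 * C + 1) * w ^ 5 + K)) := by rw [← Real.exp_add, ← Real.exp_add]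
    _ ≤ _ := by
        gcongr
        have h5 : 1 ≤ w ^ 5 := one_le_pow₀ hw1'
        have h6 : w ^ 6 ≤ w ^ 8 := pow_le_pow_right₀ hw1' (by norm_num)
        have h7 : 4 * (K + 2 * C + 2) * w ^ 5 ≤ w * w ^ 5 := by gcongr
        nlinarith

/-! ### The sum over pairs of directions and the proof of the theorem. -/

open RCNHalfspace in
theorem sum_truncatedPowerSum_score_le {η t ρ c : ℝ} (hη0 : 0 < η) (hη : η < 1 / 2)
    (hρ0 : 0 ≤ ρ) (hρ1 : ρ ≤ 1) (ht : 0 ≤ t) {d n l : ℕ}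
    {S : Finset (EuclideanSpace ℝ (Fin d))} (hS : NearlyOrthogonal c S)
    (hsum : ∑ u ∈ S, ∑ v ∈ S, (if u = v then 0 else Real.cosh (Real.sqrt d * inner ℝ u v)) ≤
      3 * (S.card : ℝ) ^ 2)
    (hτ : (d : ℝ) ^ (-(1 / 2 : ℝ) + c) ≤ 1 / 4)
    (hτt : (d : ℝ) ^ (-(1 / 2 : ℝ) + c) * t ^ 2 ≤ 1 / 4)
    (hn : n * gaussianTail t ^ 2 * (1 / η ^ 2 * (4 * Real.exp (7 / 2)) * (1 + t) ^ 2) ≤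
      1 / 12 * Real.sqrt d)
    (hdiag : 2 * (((n : ℝ) + 1) ^ l * Real.exp (1 / η ^ 2)) ≤ S.card) :
    ∑ u ∈ S, ∑ v ∈ S, truncatedPowerSum n l
      (∫ z, score η t u z * score η t v z ∂nullLaw d ρ) ≤ (S.card : ℝ) ^ 2 := by
  have hoff : ∀ u ∈ S, ∀ v ∈ S, u ≠ v → truncatedPowerSum n l
      (∫ z, score η t u z * score η t v z ∂nullLaw d ρ) ≤
        1 / 6 * Real.cosh (Real.sqrt d * inner ℝ u v) := by
    intro u hu v hv huv
    have hs := hS.2 u hu v hv huv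
    have hz := (abs_integral_score_mul_le hη0 hη hρ0 hρ1 t (hS.1 u hu) (hS.1 v hv)).trans
      (mul_le_mul_of_nonneg_left (abs_cov_halfspaceInd_le (hS.1 u hu) (hS.1 v hv) ht
        (hs.le.trans hτ) ((mul_le_mul_of_nonneg_right hs.le (sq_nonneg t)).trans hτt))
        (by positivity))
    -- The value `1/12` gives `cosh / 6` per pair, and the total `3 |S|²` of the `cosh` terms makes
    -- the off-diagonal part at most `|S|²/2`.
    have := abs_truncatedPowerSum_le_cosh (n := n) l (ε := 1 / 12)
      (z := ∫ z, score η t u z * score η t v z ∂nullLaw d ρ)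
      (y := Real.sqrt d * inner ℝ u v) (by norm_num) (by norm_num) (by
        rw [abs_mul, abs_of_nonneg (Real.sqrt_nonneg _)]
        calc _ ≤ (n : ℝ) * (1 / η ^ 2 * (4 * Real.exp (7 / 2) * |(inner ℝ u v : ℝ)| *
              (1 + t) ^ 2 * gaussianTail t ^ 2)) := by gcongr
          _ = n * gaussianTail t ^ 2 * (1 / η ^ 2 * (4 * Real.exp (7 / 2)) * (1 + t) ^ 2) *
              |(inner ℝ u v : ℝ)| := by ring
          _ ≤ 1 / 12 * Real.sqrt d * |(inner ℝ u v : ℝ)| := by gcongr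
          _ = _ := by ring)
    linarith [(abs_le.1 this).2]
  have hdg : ∀ u ∈ S, truncatedPowerSum n l
      (∫ z, score η t u z * score η t u z ∂nullLaw d ρ) ≤ 1 / 2 * S.card := by
    intro u hu
    have h0 : 0 ≤ ∫ z, score η t u z * score η t u z ∂nullLaw d ρ :=
      integral_nonneg fun z => mul_self_nonneg _
    have hz := abs_integral_score_mul_le hη0 hη hρ0 hρ1 t (hS.1 u hu) (hS.1 u hu)
    have h1 : |∫ x, halfspaceInd t u x * halfspaceInd t u x
        ∂stdGaussian (EuclideanSpace ℝ (Fin d)) - gaussianTail t ^ 2| ≤ 1 := by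
      have : ∀ x, halfspaceInd t u x * halfspaceInd t u x = halfspaceInd t u x := fun x => by
        unfold halfspaceInd; split_ifs <;> simp
      simp_rw [this]
      rw [integral_halfspaceInd t (hS.1 u hu), abs_le]
      have := gaussianTail_nonneg t
      have := gaussianTail_le_one t
      constructor <;> nlinarith
    have h2 : ∫ z, score η t u z * score η t u z ∂nullLaw d ρ ≤ 1 / η ^ 2 :=
      (le_abs_self _).trans (hz.trans (mul_le_of_le_one_right (by positivity) h1))
    have h3 := truncatedPowerSum_le h0 n l
    have h4 : ((n : ℝ) + 1) ^ l * Real.exp (∫ z, score η t u z * score η t u z ∂nullLaw d ρ) ≤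
      ((n : ℝ) + 1) ^ l * Real.exp (1 / η ^ 2) := by gcongr
    linarith
  calc ∑ u ∈ S, ∑ v ∈ S, truncatedPowerSum n l
        (∫ z, score η t u z * score η t v z ∂nullLaw d ρ)
      ≤ ∑ u ∈ S, ∑ v ∈ S, ((if u = v then 1 / 2 * (S.card : ℝ) else 0) +
          1 / 6 * (if u = v then 0 else Real.cosh (Real.sqrt d * inner ℝ u v))) := by
        refine Finset.sum_le_sum fun u hu => Finset.sum_le_sum fun v hv => ?_
        by_cases huv : u = v
        · subst huv
          simpa using hdg u hu
        · simpa [huv] using hoff u hu v hv huv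
    _ = 1 / 2 * (S.card : ℝ) ^ 2 + 1 / 6 * ∑ u ∈ S, ∑ v ∈ S,
          (if u = v then 0 else Real.cosh (Real.sqrt d * inner ℝ u v)) := by
        simp_rw [Finset.sum_add_distrib, ← Finset.mul_sum]
        congr 1
        rw [Finset.sum_congr rfl fun u hu => (Finset.sum_ite_eq S u _).trans (if_pos hu),
          Finset.sum_const, nsmul_eq_mul]
        ring
    _ ≤ _ := by linarith

theorem theoremD4 :
    ∃ κ : ℝ, 0 < κ ∧ ∃ a : ℝ, 0 < a ∧
    ∀ η : ℝ, 0 < η → η < 1 / 2 → ∀ C : ℝ, 0 < C →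
    ∃ δ : ℝ, 0 < δ ∧
    ∀ c : ℝ, 0 < c → c < 1 / 2 →
    ∃ d₀ : ℕ, ∀ d : ℕ, d₀ ≤ d →
    ∃ S : Finset (EuclideanSpace ℝ (Fin d)),
      RCNHalfspace.NearlyOrthogonal c S ∧
      (2 : ℝ) ^ (a * (d : ℝ) ^ c) ≤ (S.card : ℝ) ∧
      ∀ t p : ℝ, 0 ≤ t → p = RCNHalfspace.gaussianTail t →
        t ≤ (d : ℝ) ^ (1 / 4 - c / 2) / 2 →
        (2 : ℝ) ^ (-(C * (d : ℝ) ^ c)) ≤ p →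
      ∀ ρ : ℝ, 0 ≤ ρ → ρ ≤ 1 →
      ∀ n : ℕ, (n : ℝ) ≤ (δ * (d : ℝ)) ^ (1 / 2 - c) / p ^ 2 →
      ∀ k : ℕ, Even k → (k : ℝ) < (d : ℝ) ^ (c / 4) →
      ∀ l : ℕ, (l : ℝ) ≤ κ * (k : ℝ) →
        (∀ v ∈ S,
          RCNHalfspace.sampleLaw n (RCNHalfspace.hardLaw ρ η t v) ≪
            RCNHalfspace.sampleLaw n (RCNHalfspace.nullLaw d ρ) ∧
          MemLp
            (RCNHalfspace.likelihoodRatio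
              (RCNHalfspace.sampleLaw n (RCNHalfspace.hardLaw ρ η t v))
              (RCNHalfspace.sampleLaw n (RCNHalfspace.nullLaw d ρ)))
            2 (RCNHalfspace.sampleLaw n (RCNHalfspace.nullLaw d ρ))) ∧
        ‖RCNHalfspace.centredLDLR (RCNHalfspace.nullLaw d ρ) S
            (RCNHalfspace.hardLaw ρ η t) n ⊤ l‖ ^ 2 ≤ 1 ∧
        ∀ P : MvPolynomial (Fin n × Option (Fin d)) ℝ,
          RCNHalfspace.HasSamplewiseDegree ⊤ l P →
          |(S.card : ℝ)⁻¹ *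
              ∑ v ∈ S, ∫ X, RCNHalfspace.evalSamples P X
                ∂(RCNHalfspace.sampleLaw n (RCNHalfspace.hardLaw ρ η t v))
            - ∫ X, RCNHalfspace.evalSamples P X
                ∂(RCNHalfspace.sampleLaw n (RCNHalfspace.nullLaw d ρ))| ≤
          Real.sqrt (variance (RCNHalfspace.evalSamples P)
            (RCNHalfspace.sampleLaw n (RCNHalfspace.nullLaw d ρ))) := by
  -- `κ = 1` suffices since only `l ≤ d^(c/4)` is needed, and `a = 1` since `|S| ≥ exp (d^(2c)/4)`,
  -- which exceeds `2^(d^c)` once `d^c ≥ 6`.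
  refine ⟨1, one_pos, 1, one_pos, fun η hη0 hη C hC => ?_⟩
  set A : ℝ := 1 / η ^ 2 * (4 * Real.exp (7 / 2)) with hA
  have hA0 : 0 < A := by positivity
  set x : ℝ := min 1 (1 / (12 * (A * (2 + 4 * C)))) with hx
  have hx0 : 0 < x := lt_min one_pos (by positivity)
  have hx1 : x ≤ 1 := min_le_left _ _
  have hxA : x * (A * (2 + 4 * C)) ≤ 1 / 12 := by
    calc x * (A * (2 + 4 * C)) ≤ 1 / (12 * (A * (2 + 4 * C))) * (A * (2 + 4 * C)) := by
          gcongr; exact min_le_right _ _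
      _ = 1 / 12 := by field_simp
  refine ⟨x ^ 4, by positivity, fun c hc0 hc => ?_⟩
  obtain ⟨d₀, hd₀⟩ := exists_forall_le_rpow hc0 hc
    (max 6 (max (4 * (1 / η ^ 2 + 2 * C + 2)) (1 + 2 / c))) (36 * A)
  refine ⟨d₀, fun d hd => ?_⟩
  obtain ⟨hd0, hw, hτ, hlarge⟩ := hd₀ d hd
  have hw6 := (le_max_left _ _).trans hw
  have hwK := ((le_max_left _ _).trans (le_max_right _ _)).trans hw
  have hwc := ((le_max_right _ _).trans (le_max_right _ _)).trans hw
  have hd1 : (1 : ℝ) ≤ d := by exact_mod_cast hd0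
  have hdpos : (0 : ℝ) < d := by linarith
  have hy6 : 6 ≤ (d : ℝ) ^ c :=
    hw6.trans (Real.rpow_le_rpow_of_exponent_le hd1 (by linarith))
  obtain ⟨N, hN, hNE⟩ := exists_card hy6
  obtain ⟨S, hS, hSN, hSsum⟩ := RCNHalfspace.exists_nearlyOrthogonal hd0 hc.le N hN
  have hcard : Real.exp (((d : ℝ) ^ c) ^ 2 / 4) ≤ S.card := by rw [hSN]; exact hNE
  refine ⟨S, hS, ?_, ?_⟩
  · refine le_trans ?_ hcard
    rw [Real.rpow_def_of_pos two_pos, Real.exp_le_exp]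
    have := Real.log_two_lt_d9
    nlinarith
  intro t p ht hp ht4 hpC ρ hρ0 hρ1 n hn k _ hk l hl
  subst hp
  have hSne : S.Nonempty := by
    rw [← Finset.card_pos]
    exact_mod_cast (Real.exp_pos _).trans_le hcard
  have hp0 : 0 < RCNHalfspace.gaussianTail t :=
    (Real.rpow_pos_of_pos two_pos _).trans_le hpC
  have ht1 : t ^ 2 ≤ 2 * C * (d : ℝ) ^ c := sq_le_of_le_gaussianTail ht (by positivity) hpC
  have ht2 : t ^ 2 ≤ (d : ℝ) ^ (1 / 2 - c) / 4 := by
    calc t ^ 2 ≤ ((d : ℝ) ^ (1 / 4 - c / 2) / 2) ^ 2 := by gcongr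
      _ = _ := by
        rw [div_pow, ← Real.rpow_natCast, ← Real.rpow_mul hdpos.le]
        norm_num
        ring_nf
  -- The upper bound on `t` is exactly what keeps `|u·v| t² ≤ 1/4`, as the covariance estimate
  -- requires.
  have hτt : (d : ℝ) ^ (-(1 / 2 : ℝ) + c) * t ^ 2 ≤ 1 / 4 := by
    calc (d : ℝ) ^ (-(1 / 2 : ℝ) + c) * t ^ 2
        ≤ (d : ℝ) ^ (-(1 / 2 : ℝ) + c) * ((d : ℝ) ^ (1 / 2 - c) / 4) := by gcongr
      _ = 1 / 4 := by
        rw [mul_div_assoc', ← Real.rpow_add hdpos]; ring_nf; simp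
  have hn' : (n : ℝ) * RCNHalfspace.gaussianTail t ^ 2 ≤ (x ^ 4 * (d : ℝ)) ^ (1 / 2 - c) :=
    (le_div_iff₀ (by positivity)).1 hn
  have hprob := RCNHalfspace.isProbabilityMeasure_labelMixture hρ0 hρ1
    (stdGaussian (EuclideanSpace ℝ (Fin d))) (stdGaussian (EuclideanSpace ℝ (Fin d)))
  refine RCNHalfspace.low_degree_indistinguishable hSne
    (RCNHalfspace.integrable_prod_sampleCoord_pow_nullLaw ρ)
    (RCNHalfspace.measurable_score η t) (RCNHalfspace.abs_score_le hη0 hη t)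
    (RCNHalfspace.one_add_score_nonneg hη0 hη t)
    (fun v hv => RCNHalfspace.integral_score hρ0 hρ1 η t (hS.1 v hv))
    (fun v _ => RCNHalfspace.hardLaw_eq_withDensity hη0 hη ρ t v)
    (sum_truncatedPowerSum_score_le hη0 hη hρ0 hρ1 ht hS (by rw [hSN]; exact hSsum) hτ hτt ?_ ?_)
  · refine le_trans ?_ (rpow_mul_one_add_sq_le hA0 hc0 hc hx0 hx1 hxA hd0 hlarge ht1 ht2)
    gcongr
  · refine (two_mul_pow_mul_exp_le hC (by positivity) hc0 hd0 hwK hwc hpC ?_ ?_).trans hcard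
    · refine hn.trans ?_
      gcongr
      exact mul_le_of_le_one_left hdpos.le (pow_le_one₀ hx0.le hx1)
    · linarith
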